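/- Let $s\ge 2$ be an integer and $\eta\in(0,1]$ a real number, with $(s,\eta)\neq(2,1)$. For a finite $s$-uniform hypergraph $B$ let $\delta(B)=|B|-\eta\,|R[B]|$, where $R[B]$ is the set of hyperedges of $B$. For finite induced subhypergraphs $A\subseteq B$ write $A\leqslant B$ if $\delta(A)\le\delta(B')$ for all $A\subseteq B'\subseteq B$; for a finite subset $A$ of an infinite hypergraph $N$ write $A\leqslant N$ if $A\leqslant B$ for every finite $B\subseteq N$ containing $A$. Let $\mathcal C_\eta$ be the class of finite $s$-uniform hypergraphs $B$ with $\emptyset\leqslant B$. Let $\mathcal M^\eta$ be the Hrushovski generic structure, that is, the (up to isomorphism unique) countable $s$-uniform hypergraph such that (1) the finite induced subhypergraphs of $\mathcal M^\eta$ are, up to isomorphism, exactly the members of $\mathcal C_\eta$; (2) $\mathcal M^\eta$ is the union of a chain $(A_i)_{i\in\omega}$ of finite subsets with $A_i\leqslant\mathcal M^\eta$; (3) if $A\leqslant\mathcal M^\eta$ is finite and $A\leqslant B\in\mathcal C_\eta$, then there is an embedding $f:B\to\mathcal M^\eta$ with $f|_A=\mathrm{id}_A$ and $f(B)\leqslant\mathcal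 M^\eta$. Then the Zariski topology on $G=\mathrm{Aut}(\mathcal M^\eta)$, that is, the topology generated by the sets $\{x\in G : x^{\epsilon_1}g_1x^{\epsilon_2}g_2\cdots x^{\epsilon_n}g_n\neq 1\}$ with $n\in\mathbb N$, $g_i\in G$, $\epsilon_i\in\{1,-1\}$, is not a group topology. -/

import Mathlib

/-- An `s`-uniform hypergraph on the vertex set `V`: a family of `s`-element subsets of `V`
(equivalently, a structure with one symmetric irreflexive `s`-ary relation). -/
structure UniformHypergraph (s : ℕ) (V : Type*) where
  /-- The set of hyperedges. -/
  edges : Set (Finset V)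
  card_eq : ∀ e ∈ edges, e.card = s

namespace UniformHypergraph

variable {s : ℕ} {V W : Type*}

/-- The induced substructure on a set of vertices. -/
def induce (H : UniformHypergraph s V) (A : Set V) : UniformHypergraph s A where
  edges := {e | e.map (Function.Embedding.subtype _) ∈ H.edges}
  card_eq := fun e he => by
    have h := H.card_eq _ he
    rwa [Finset.card_map] at h

/-- An injection of vertex sets is an embedding of structures if it preserves and reflects
hyperedges. -/
def IsEmbedding (H : UniformHypergraph s V) (K : UniformHypergraph s W) (f : V ↪ W) : Prop :=
  ∀ e : Finset V, e.map f ∈ K.edges ↔ e ∈ H.edges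

open Classical in
/-- `R[B]`: the finite set of hyperedges contained in the finite vertex set `B`. -/
noncomputable def edgesIn (H : UniformHypergraph s V) (B : Finset V) : Finset (Finset V) :=
  B.powerset.filter (fun e => e ∈ H.edges)

/-- The predimension `δ(B) = |B| - η |R[B]|` of the substructure on a finite vertex set `B`. -/
noncomputable def predim (η : ℝ) (H : UniformHypergraph s V) (B : Finset V) : ℝ :=
  (B.card : ℝ) - η * ((H.edgesIn B).card : ℝ)

/-- `A ⩽ B` for finite substructures `A ⊆ B`: one has `δ(A) ≤ δ(B')` for all `A ⊆ B' ⊆ B`. -/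
def StrongIn (η : ℝ) (H : UniformHypergraph s V) (A B : Finset V) : Prop :=
  A ⊆ B ∧ ∀ B' : Finset V, A ⊆ B' → B' ⊆ B → H.predim η A ≤ H.predim η B'

/-- `A ⩽ H` for a finite vertex set `A` of a finite or infinite structure `H`: one has `A ⩽ B`
for every finite substructure `B` that contains `A`. -/
def Strong (η : ℝ) (H : UniformHypergraph s V) (A : Finset V) : Prop :=
  ∀ B : Finset V, A ⊆ B → H.StrongIn η A B

/-- Membership in the class `𝓒_η` of the finite hypergraphs `K` with `∅ ⩽ K`. -/
def InClass (η : ℝ) (K : UniformHypergraph s V) : Prop :=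
  Finite V ∧ K.Strong η ∅

/-- `H` is a Hrushovski generic structure for the predimension with coefficient `η`. Finite
structures are represented, up to isomorphism, by structures on `Fin n`. -/
structure IsHrushovskiGeneric (η : ℝ) (H : UniformHypergraph s V) : Prop where
  countable : Countable V
  /-- The finite substructures of `H` are, up to isomorphism, exactly the members of `𝓒_η`. -/
  age : ∀ (n : ℕ) (K : UniformHypergraph s (Fin n)),
    (∃ f : Fin n ↪ V, K.IsEmbedding H f) ↔ K.InClass η
  /-- `H` is the union of a chain of finite strong subsets. -/
  chain : ∃ A : ℕ → Finset V,
    Monotone A ∧ (∀ i, H.Strong η (A i)) ∧ ∀ v : V, ∃ i, v ∈ A i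
  /-- If `A ⩽ H` and `A ⩽ K ∈ 𝓒_η` (the inclusion of `A` in `K` being `g`), then `K` embeds in `H`
  over `A` with strong image. -/
  extension : ∀ A : Finset V, H.Strong η A →
    ∀ (n : ℕ) (K : UniformHypergraph s (Fin n)), K.InClass η →
    ∀ g : (A : Set V) ↪ Fin n, (H.induce (A : Set V)).IsEmbedding K g →
      K.Strong η (Finset.univ.map g) →
      ∃ f : Fin n ↪ V, K.IsEmbedding H f ∧ (∀ a, f (g a) = (a : V)) ∧
        H.Strong η (Finset.univ.map f)

/-- The automorphism group of a hypergraph, as a group of permutations of the vertices. -/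
def Aut (H : UniformHypergraph s V) : Subgroup (Equiv.Perm V) where
  carrier := {g | H.IsEmbedding H g.toEmbedding}
  mul_mem' := by
    intro a b ha hb e
    have h : e.map (a * b).toEmbedding = (e.map b.toEmbedding).map a.toEmbedding := by
      rw [Finset.map_map]; rfl
    rw [h]
    exact (ha _).trans (hb e)
  one_mem' := by
    intro e
    have h : e.map (1 : Equiv.Perm V).toEmbedding = e := Finset.map_refl
    rw [h]
  inv_mem' := by
    intro a ha e
    have h : (e.map (a⁻¹).toEmbedding).map a.toEmbedding = e := by
      rw [Finset.map_map]
      convert Finset.map_refl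
      ext x
      exact a.apply_symm_apply x
    have h2 := ha (e.map (a⁻¹).toEmbedding)
    rw [h] at h2
    exact h2.symm

end UniformHypergraph

/-- The Zariski topology of a group `G`, generated by the sets
`{x | x ^ ε₁ * g₁ * x ^ ε₂ * g₂ * ⋯ * x ^ εₙ * gₙ ≠ 1}` with `gᵢ ∈ G` and `εᵢ ∈ {1, -1}`. -/
abbrev groupZariskiTopology (G : Type*) [Group G] : TopologicalSpace G :=
  TopologicalSpace.generateFrom
    {U | ∃ w : List (ℤˣ × G), U = {x : G | (w.map fun p => x ^ (p.1 : ℤ) * p.2).prod ≠ 1}}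

/-! The Zariski topology of a group is T1, and a T1 topological group is Hausdorff. The group `Aut`
is nontrivial, so it suffices that finitely many nonempty basic Zariski open sets always meet
(`exists_mem_sInter`): then two distinct points have no disjoint neighbourhoods. The common point is
found by Baire-style approximation in the topology of pointwise convergence. For a nonempty reduced
word `w` and any value `c`, every finite partial condition on an automorphism has a finite
refinement that forces `w(y) ≠ c` (`exists_evalWord_ne`), and such conditions can be met one after
another.

To force `w(y) ≠ c`, a vertex is followed through the word from right to left while a finite part of
`y` is being decided (`exists_path`). The invariant is that, before each letter, the vertex has
relative dimension at least `η` over the decided domain or range, so that its next image is still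
free to choose. The delicate place is a sign change around a constant `g ≠ 1`: the image must be
chosen such that `g` takes it away from both the domain and the range (`exists_independent_image`).

This rests on `exists_generic_copy`. A copy of the vertex is joined by `k` hyperedges to blocks `ℓ`
of `s - 1` vertices, where the blocks `ℓ` and `g • ℓ` are independent up to a defect. The links
leave the copy a relative dimension below `η` over a large strong set, which is too little room for
its `g`-image to be related to it: the two must be freely amalgamated. The dimension of the pair is
then computed from that of the blocks.

Blocks are obtained by moving a vertex with `g`, attaching new hyperedges until a moved vertex is
free (`exists_moved_free`). For `s ≥ 3` a free block already suffices. For `s = 2` the defect is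
lowered by `1 - η` at a time, by feeding blocks with a defect into `exists_generic_copy`. Both
arguments need `(s, η) ≠ (2, 1)`. -/

namespace UniformHypergraph

/-! ### Predimension and submodularity. -/

section Predimension

open Classical in
/-- The hyperedges inside `X ∪ Y` that lie neither inside `X` nor inside `Y`. -/
noncomputable def crossEdges {s : ℕ} {V : Type*} (H : UniformHypergraph s V) (X Y : Finset V) :
    Finset (Finset V) :=
  (H.edgesIn (X ∪ Y)).filter (fun e => ¬ e ⊆ X ∧ ¬ e ⊆ Y)

open Classical

variable {s : ℕ} {V W : Type*} {η : ℝ} {H : UniformHypergraph s V}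

lemma mem_edgesIn {B e : Finset V} : e ∈ H.edgesIn B ↔ e ⊆ B ∧ e ∈ H.edges := by
  simp [edgesIn]

lemma mem_crossEdges {X Y e : Finset V} :
    e ∈ H.crossEdges X Y ↔ e ⊆ X ∪ Y ∧ e ∈ H.edges ∧ ¬ e ⊆ X ∧ ¬ e ⊆ Y := by
  simp [crossEdges, mem_edgesIn, and_assoc]

/-- Inclusion-exclusion for vertices and hyperedges. The exact error term matters later: absence of
crossing hyperedges is what free amalgamation means. -/
lemma predim_union_add_inter (η : ℝ) (H : UniformHypergraph s V) (X Y : Finset V) :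
    H.predim η (X ∪ Y) + H.predim η (X ∩ Y) + η * (H.crossEdges X Y).card =
      H.predim η X + H.predim η Y := by
  have h1 : H.edgesIn (X ∪ Y) = (H.edgesIn X ∪ H.edgesIn Y) ∪ H.crossEdges X Y := by
    ext e
    simp only [mem_edgesIn, Finset.mem_union, mem_crossEdges]
    have := @Finset.subset_union_left _ _ X Y
    have := @Finset.subset_union_right _ _ X Y
    constructor
    · tauto
    · rintro ((⟨h, h'⟩ | ⟨h, h'⟩) | h)
      · exact ⟨h.trans ‹_›, h'⟩
      · exact ⟨h.trans ‹_›, h'⟩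
      · exact ⟨h.1, h.2.1⟩
  have h2 : Disjoint (H.edgesIn X ∪ H.edgesIn Y) (H.crossEdges X Y) := by
    rw [Finset.disjoint_left]
    intro e
    simp only [mem_edgesIn, Finset.mem_union, mem_crossEdges]
    tauto
  have h3 : H.edgesIn (X ∩ Y) = H.edgesIn X ∩ H.edgesIn Y := by
    ext e
    simp only [mem_edgesIn, Finset.mem_inter, Finset.subset_inter_iff]
    tauto
  have h4 : (H.edgesIn (X ∪ Y)).card + (H.edgesIn (X ∩ Y)).card =
      (H.edgesIn X).card + (H.edgesIn Y).card + (H.crossEdges X Y).card := by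
    rw [h1, Finset.card_union_of_disjoint h2, h3]
    have := Finset.card_union_add_card_inter (H.edgesIn X) (H.edgesIn Y)
    omega
  have h5 := Finset.card_union_add_card_inter X Y
  have h4' : ((H.edgesIn (X ∪ Y)).card : ℝ) + (H.edgesIn (X ∩ Y)).card =
      (H.edgesIn X).card + (H.edgesIn Y).card + (H.crossEdges X Y).card := by exact_mod_cast h4
  have h5' : ((X ∪ Y).card : ℝ) + (X ∩ Y).card = X.card + Y.card := by exact_mod_cast h5
  simp only [predim]
  linear_combination h5' - η * h4'

lemma predim_submodular (hη : 0 ≤ η) (H : UniformHypergraph s V) (X Y : Finset V) :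
    H.predim η (X ∪ Y) + H.predim η (X ∩ Y) ≤ H.predim η X + H.predim η Y := by
  have := predim_union_add_inter η H X Y
  have : 0 ≤ η * (H.crossEdges X Y).card := by positivity
  linarith

lemma strong_iff {A : Finset V} :
    H.Strong η A ↔ ∀ X, A ⊆ X → H.predim η A ≤ H.predim η X :=
  ⟨fun h X hX => (h X hX).2 X hX subset_rfl, fun h _ hB => ⟨hB, fun X hX _ => h X hX⟩⟩

/-- Used throughout to reduce a lower bound for arbitrary finite sets to subsets of one known strong
set. -/
lemma Strong.predim_inter_le (hη : 0 ≤ η) {A : Finset V} (h : H.Strong η A) (X : Finset V) :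
    H.predim η (X ∩ A) ≤ H.predim η X := by
  have h1 := predim_submodular hη H X A
  have h2 := strong_iff.1 h (X ∪ A) Finset.subset_union_right
  linarith

/-- A lower bound for the predimension of supersets of `D` transfers to supersets of a smaller
strong set. -/
lemma Strong.le_of_le_union (hη : 0 ≤ η) {A D X : Finset V} (h : H.Strong η A) (hAD : A ⊆ D)
    (hAX : A ⊆ X) {t : ℝ} (ht : H.predim η D + t ≤ H.predim η (X ∪ D)) :
    H.predim η A + t ≤ H.predim η X := by
  have h1 := predim_submodular hη H X D
  have h2 := strong_iff.1 h (X ∩ D) (Finset.subset_inter hAX hAD)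
  linarith

lemma IsEmbedding.edgesIn_map {K : UniformHypergraph s W} {f : W ↪ V} (hf : K.IsEmbedding H f)
    (X : Finset W) :
    H.edgesIn (X.map f) = (K.edgesIn X).map (Finset.mapEmbedding f).toEmbedding := by
  ext e
  simp only [mem_edgesIn, Finset.mem_map, RelEmbedding.coe_toEmbedding, Finset.mapEmbedding_apply]
  constructor
  · rintro ⟨h, he⟩
    obtain ⟨u, hu, rfl⟩ := Finset.subset_map_iff.1 h
    exact ⟨u, ⟨hu, (hf u).1 he⟩, rfl⟩
  · rintro ⟨u, ⟨hu, hu'⟩, rfl⟩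
    exact ⟨Finset.map_subset_map.2 hu, (hf u).2 hu'⟩

lemma IsEmbedding.predim_map {K : UniformHypergraph s W} {f : W ↪ V} (hf : K.IsEmbedding H f)
    (X : Finset W) : H.predim η (X.map f) = K.predim η X := by
  simp [predim, hf.edgesIn_map]

/-- The hypergraph induced along an injection. -/
def comap (H : UniformHypergraph s V) (f : W ↪ V) : UniformHypergraph s W where
  edges := {e | e.map f ∈ H.edges}
  card_eq := fun e he => by simpa using H.card_eq _ he

lemma isEmbedding_comap (H : UniformHypergraph s V) (f : W ↪ V) :
    (H.comap f).IsEmbedding H f := fun _ => Iff.rfl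

lemma predim_empty (hs : s ≠ 0) : H.predim η ∅ = 0 := by
  have : H.edgesIn ∅ = ∅ := by
    ext e
    simp only [mem_edgesIn, Finset.subset_empty, Finset.notMem_empty, iff_false, not_and]
    rintro rfl h
    exact hs (by simpa using (H.card_eq _ h).symm)
  simp [predim, this]

lemma predim_singleton (hs : 2 ≤ s) (v : V) : H.predim η {v} = 1 := by
  have : H.edgesIn {v} = ∅ := by
    ext e
    simp only [mem_edgesIn, Finset.notMem_empty, iff_false, not_and]
    intro h he
    have h1 := H.card_eq _ he
    have h2 := Finset.card_le_card h
    simp only [Finset.card_singleton] at h2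
    omega
  simp [predim, this]

end Predimension

/-! ### Closures and the extension property of the generic structure. -/

section Generic

open Classical

variable {s : ℕ} {V W : Type*} {η : ℝ} {H : UniformHypergraph s V}

lemma IsHrushovskiGeneric.predim_nonneg (hs : s ≠ 0) (hH : H.IsHrushovskiGeneric η)
    (X : Finset V) : 0 ≤ H.predim η X := by
  let σ := X.equivFin.symm
  let f : Fin X.card ↪ V := σ.toEmbedding.trans (Function.Embedding.subtype _)
  have hf := isEmbedding_comap H f
  have h1 := ((hH.age _ _).1 ⟨f, hf⟩).2
  have h2 := strong_iff.1 h1 Finset.univ (Finset.empty_subset _)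
  have h3 : Finset.univ.map f = X := by
    ext v
    simp only [Finset.mem_map, Finset.mem_univ, true_and]
    constructor
    · rintro ⟨i, rfl⟩
      exact (σ i).2
    · intro hv
      exact ⟨σ.symm ⟨v, hv⟩, by simp [f]⟩
  rw [predim_empty hs, ← hf.predim_map, h3] at h2
  exact h2

lemma IsHrushovskiGeneric.strong_empty (hs : s ≠ 0) (hH : H.IsHrushovskiGeneric η) :
    H.Strong η ∅ :=
  strong_iff.2 fun X _ => by rw [predim_empty hs]; exact hH.predim_nonneg hs X

lemma IsHrushovskiGeneric.exists_strong (hH : H.IsHrushovskiGeneric η) (X : Finset V) :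
    ∃ A, X ⊆ A ∧ H.Strong η A := by
  obtain ⟨A, hA, hst, hcov⟩ := hH.chain
  choose i hi using hcov
  refine ⟨A (X.sup i), fun v hv => hA (Finset.le_sup hv) (hi v), hst _⟩

/-- The closure of a finite set: a strong superset of minimal predimension. -/
lemma IsHrushovskiGeneric.exists_closure (hη : 0 ≤ η) (hH : H.IsHrushovskiGeneric η)
    (X : Finset V) :
    ∃ B, X ⊆ B ∧ H.Strong η B ∧ ∀ Y, X ⊆ Y → H.predim η B ≤ H.predim η Y := by
  obtain ⟨A, hXA, hA⟩ := hH.exists_strong X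
  obtain ⟨B, hB, hmin⟩ := Finset.exists_min_image (A.powerset.filter (X ⊆ ·)) (H.predim η)
    ⟨A, by simp [hXA]⟩
  simp only [Finset.mem_filter, Finset.mem_powerset] at hB hmin
  have key : ∀ Y, X ⊆ Y → H.predim η B ≤ H.predim η Y := fun Y hY =>
    (hmin (Y ∩ A) ⟨Finset.inter_subset_right, Finset.subset_inter hY hXA⟩).trans
      (hA.predim_inter_le hη Y)
  exact ⟨B, hB.2, strong_iff.2 fun Y hY => key Y (hB.2.trans hY), key⟩

/-- The extension property for structures on an arbitrary finite type. -/
lemma IsHrushovskiGeneric.extension_fintype [Fintype W] (hs : s ≠ 0)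
    (hH : H.IsHrushovskiGeneric η) {A : Finset V}
    (hA : H.Strong η A) (K : UniformHypergraph s W) (hK : ∀ X, 0 ≤ K.predim η X)
    (g : (A : Set V) ↪ W) (hg : (H.induce (A : Set V)).IsEmbedding K g)
    (hgs : K.Strong η (Finset.univ.map g)) :
    ∃ f : W ↪ V, K.IsEmbedding H f ∧ (∀ a, f (g a) = (a : V)) ∧
      H.Strong η (Finset.univ.map f) := by
  let σ := Fintype.equivFin W
  let K' := K.comap σ.symm.toEmbedding
  have hσ : K'.IsEmbedding K σ.symm.toEmbedding := isEmbedding_comap _ _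
  have hcls : K'.InClass η := by
    refine ⟨inferInstance, strong_iff.2 fun X _ => ?_⟩
    rw [predim_empty hs, ← hσ.predim_map]
    exact hK _
  have hmm : ∀ e : Finset (A : Set V), (e.map (g.trans σ.toEmbedding)).map σ.symm.toEmbedding
      = e.map g := by
    intro e
    rw [Finset.map_map]
    congr 1
    ext x
    simp
  have hstr : K'.Strong η (Finset.univ.map (g.trans σ.toEmbedding)) := by
    rw [strong_iff]
    intro X hX
    rw [← hσ.predim_map, ← hσ.predim_map, hmm]
    refine strong_iff.1 hgs _ ?_
    rw [← hmm]
    exact Finset.map_subset_map.2 hX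
  obtain ⟨f, hf, hfg, hfs⟩ := hH.extension A hA _ K' hcls (g.trans σ.toEmbedding)
    (by
      intro e
      change (e.map (g.trans σ.toEmbedding)).map σ.symm.toEmbedding ∈ K.edges ↔ _
      rw [hmm]
      exact hg e) hstr
  refine ⟨σ.toEmbedding.trans f, ?_, fun a => by simpa using hfg a, ?_⟩
  · intro e
    rw [← Finset.map_map, hf]
    change (e.map σ.toEmbedding).map σ.symm.toEmbedding ∈ K.edges ↔ _
    rw [Finset.map_map]
    simp
  · convert hfs using 1
    rw [← Finset.map_map]
    simp

/-- Realization, over a finite strong set `E`, of finitely many new vertices indexed by `ι` with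
prescribed new hyperedges `𝓕`. -/
lemma IsHrushovskiGeneric.exists_extension {ι : Type*} [Fintype ι] (hs : s ≠ 0)
    (hH : H.IsHrushovskiGeneric η) {E : Finset V} (hE : H.Strong η E)
    (𝓕 : Finset (Finset (V ⊕ ι))) (hcard : ∀ e ∈ 𝓕, e.card = s)
    (hne : ∀ e ∈ 𝓕, e.toRight.Nonempty)
    (hδ : ∀ I : Finset ι, η * (𝓕.filter (fun e => e.toRight ⊆ I)).card ≤ I.card)
    (hη : 0 ≤ η) :
    ∃ z : ι ↪ V, (∀ i, z i ∉ E) ∧ H.Strong η (E ∪ Finset.univ.map z) ∧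
      ∀ e : Finset (V ⊕ ι), e.toLeft ⊆ E → e.toRight.Nonempty →
        (e.image (Sum.elim id z) ∈ H.edges ↔ e ∈ 𝓕) := by
  let Ĥ : UniformHypergraph s (V ⊕ ι) :=
    { edges := {e | (∃ e₀ ∈ H.edges, e = e₀.map Function.Embedding.inl) ∨ e ∈ 𝓕}
      card_eq := by
        rintro e (⟨e₀, he₀, rfl⟩ | he)
        · simpa using H.card_eq _ he₀
        · exact hcard _ he }
  have hpre : ∀ X : Finset (V ⊕ ι), Ĥ.predim η X =
      H.predim η X.toLeft + (X.toRight.card - η * (𝓕.filter (fun e => e ⊆ X)).card) := by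
    intro X
    have h1 : Ĥ.edgesIn X = (H.edgesIn X.toLeft).map
        (Finset.mapEmbedding Function.Embedding.inl).toEmbedding ∪
          𝓕.filter (fun e => e ⊆ X) := by
      ext e
      simp only [mem_edgesIn, Finset.mem_union, Finset.mem_map, RelEmbedding.coe_toEmbedding,
        Finset.mapEmbedding_apply, Finset.mem_filter]
      constructor
      · rintro ⟨h, ⟨e₀, he₀, rfl⟩ | he⟩
        · exact Or.inl ⟨e₀, ⟨Finset.map_inl_subset_iff_subset_toLeft.1 h, he₀⟩, rfl⟩
        · exact Or.inr ⟨he, h⟩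
      · rintro (⟨e₀, ⟨h, he₀⟩, rfl⟩ | ⟨he, h⟩)
        · exact ⟨Finset.map_inl_subset_iff_subset_toLeft.2 h, Or.inl ⟨e₀, he₀, rfl⟩⟩
        · exact ⟨h, Or.inr he⟩
    have h2 : Disjoint ((H.edgesIn X.toLeft).map
        (Finset.mapEmbedding (Function.Embedding.inl : V ↪ V ⊕ ι)).toEmbedding)
          (𝓕.filter (fun e => e ⊆ X)) := by
      rw [Finset.disjoint_left]
      intro e he he'
      simp only [Finset.mem_map, RelEmbedding.coe_toEmbedding,
        Finset.mapEmbedding_apply] at he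
      obtain ⟨e₀, -, rfl⟩ := he
      obtain ⟨i, hi⟩ := hne _ (Finset.mem_filter.1 he').1
      simp at hi
    have h3 : (X.card : ℝ) = X.toLeft.card + X.toRight.card := by
      exact_mod_cast Finset.card_toLeft_add_card_toRight.symm
    simp only [predim]
    rw [h1, Finset.card_union_of_disjoint h2, Finset.card_map, h3]
    push_cast
    ring
  -- Discarding the new vertices never raises the predimension. This gives both membership of the
  -- extension in the class and strongness of `E` in it.
  have hge : ∀ X : Finset (V ⊕ ι), H.predim η X.toLeft ≤ Ĥ.predim η X := by
    intro X
    rw [hpre]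
    have h1 := hδ X.toRight
    have h2 : (𝓕.filter (fun e => e ⊆ X)).card ≤
        (𝓕.filter (fun e => e.toRight ⊆ X.toRight)).card :=
      Finset.card_le_card (Finset.monotone_filter_right _
        fun e _ he => Finset.toRight_subset_toRight he)
    have h3 : η * ((𝓕.filter (fun e => e ⊆ X)).card : ℝ) ≤
        η * (𝓕.filter (fun e => e.toRight ⊆ X.toRight)).card := by gcongr
    linarith
  let j : ((E : Set V) ⊕ ι) ↪ V ⊕ ι :=
    (Function.Embedding.subtype (· ∈ (E : Set V))).sumMap (Function.Embedding.refl ι)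
  let K := Ĥ.comap j
  have hj : K.IsEmbedding Ĥ j := isEmbedding_comap _ _
  have hinl : ∀ e : Finset (E : Set V), (e.map Function.Embedding.inl).map j =
      (e.map (Function.Embedding.subtype _)).map Function.Embedding.inl := by
    intro e
    rw [Finset.map_map, Finset.map_map]
    rfl
  obtain ⟨f, hf, hfg, hfs⟩ := hH.extension_fintype hs hE K
    (fun X => by
      rw [← hj.predim_map]
      exact (hH.predim_nonneg hs _).trans (hge _))
    Function.Embedding.inl
    (by
      intro e
      change (e.map Function.Embedding.inl).map j ∈ Ĥ.edges ↔
        e.map (Function.Embedding.subtype _) ∈ H.edges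
      rw [hinl]
      constructor
      · rintro (⟨e₀, he₀, h⟩ | h)
        · rwa [Finset.map_injective _ h]
        · obtain ⟨i, hi⟩ := hne _ h
          simp at hi
      · exact fun h => Or.inl ⟨_, h, rfl⟩)
    (by
      rw [strong_iff]
      intro X hX
      rw [← hj.predim_map, ← hj.predim_map, hinl]
      have h1 : (Finset.univ : Finset (E : Set V)).map
          (Function.Embedding.subtype (· ∈ (E : Set V))) = E := by
        ext v
        simp
      rw [h1]
      have h2 : Ĥ.predim η (E.map Function.Embedding.inl) = H.predim η E := by
        rw [hpre]
        have : 𝓕.filter (fun e => e ⊆ E.map Function.Embedding.inl) = ∅ := by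
          rw [Finset.filter_eq_empty_iff]
          intro e he h
          obtain ⟨i, hi⟩ := hne _ he
          have := h (Finset.mem_toRight.1 hi)
          simp at this
        rw [this]
        have h3 : (E.map (Function.Embedding.inl : V ↪ V ⊕ ι)).toLeft = E := by ext; simp
        have h4 : (E.map (Function.Embedding.inl : V ↪ V ⊕ ι)).toRight = ∅ := by ext; simp
        rw [h3, h4]
        simp
      rw [h2]
      refine (strong_iff.1 hE _ ?_).trans (hge _)
      intro v hv
      have := hX (Finset.mem_map_of_mem Function.Embedding.inl
        (Finset.mem_univ (⟨v, hv⟩ : (E : Set V))))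
      have := Finset.mem_map_of_mem j this
      simpa [j] using this)
  have hfl : ∀ v (hv : v ∈ E), f (Sum.inl ⟨v, hv⟩) = v := fun v hv => hfg ⟨v, hv⟩
  refine ⟨Function.Embedding.inr.trans f, ?_, ?_, ?_⟩
  · intro i hi
    have h1 : f (Sum.inr i) = f (Sum.inl ⟨_, hi⟩) := (hfl _ hi).symm
    simpa using f.injective h1
  · convert hfs using 1
    ext v
    simp only [Finset.mem_union, Finset.mem_map, Finset.mem_univ, true_and]
    constructor
    · rintro (hv | ⟨i, rfl⟩)
      · exact ⟨_, hfl v hv⟩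
      · exact ⟨Sum.inr i, rfl⟩
    · rintro ⟨x | i, rfl⟩
      · left
        rw [hfl _ x.2]
        exact x.2
      · exact Or.inr ⟨i, rfl⟩
  · intro e hle hre
    obtain ⟨e', rfl⟩ : ∃ e' : Finset ((E : Set V) ⊕ ι), e = e'.map j := by
      refine ⟨e.preimage j j.injective.injOn, ?_⟩
      rw [Finset.map_eq_image, Finset.image_preimage, Finset.filter_true_of_mem]
      rintro (v | i) hx
      · exact ⟨Sum.inl ⟨v, hle (Finset.mem_toLeft.2 hx)⟩, rfl⟩
      · exact ⟨Sum.inr i, rfl⟩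
    have h1 : (e'.map j).image (Sum.elim id (Function.Embedding.inr.trans f)) = e'.map f := by
      rw [Finset.map_eq_image, Finset.image_image, Finset.map_eq_image]
      refine Finset.image_congr ?_
      rintro (x | i) -
      · exact (hfl _ x.2).symm
      · rfl
    rw [h1, hf]
    change e'.map j ∈ Ĥ.edges ↔ _
    constructor
    · rintro (⟨e₀, -, h⟩ | h)
      · rw [h] at hre
        obtain ⟨i, hi⟩ := hre
        simp at hi
      · exact h
    · exact Or.inr

end Generic

end UniformHypergraph

namespace UniformHypergraph

/-! ### Amalgamating linked copies, and homogeneity by back-and-forth. -/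

section PartialIso

open Classical

variable {s : ℕ} {V : Type*} {η : ℝ} {H : UniformHypergraph s V}

/-- `ψ` restricts to an isomorphism from the induced structure on `A` to the one on its image. -/
structure IsPartialIso (H : UniformHypergraph s V) (A : Finset V) (ψ : V → V) : Prop where
  injOn : Set.InjOn ψ (A : Set V)
  edges_iff : ∀ e ⊆ A, e.image ψ ∈ H.edges ↔ e ∈ H.edges

lemma eq_of_image_eq_of_injOn {α β : Type*} [DecidableEq β] {f : α → β} {B e e' : Finset α}
    (hf : Set.InjOn f (B : Set α)) (he : e ⊆ B) (he' : e' ⊆ B) (h : e.image f = e'.image f) :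
    e = e' := by
  have h' : f '' (e : Set α) = f '' (e' : Set α) := by
    rw [← Finset.coe_image, ← Finset.coe_image, h]
  exact_mod_cast (hf.image_eq_image_iff (by exact_mod_cast he) (by exact_mod_cast he')).1 h'

lemma IsPartialIso.inv [Nonempty V] {A : Finset V} {ψ : V → V} (h : H.IsPartialIso A ψ) :
    H.IsPartialIso (A.image ψ) (Function.invFunOn ψ (A : Set V)) ∧
      (A.image ψ).image (Function.invFunOn ψ (A : Set V)) = A ∧
      ∀ a ∈ A, Function.invFunOn ψ (A : Set V) (ψ a) = a := by
  have key : ∀ a ∈ A, Function.invFunOn ψ (A : Set V) (ψ a) = a :=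
    fun a ha => h.injOn.leftInvOn_invFunOn (by exact_mod_cast ha)
  have himg : ∀ u ⊆ A, (u.image ψ).image (Function.invFunOn ψ (A : Set V)) = u := by
    intro u hu
    rw [Finset.image_image]
    conv_rhs => rw [← Finset.image_id (s := u)]
    exact Finset.image_congr fun a ha => key a (hu ha)
  refine ⟨⟨?_, ?_⟩, himg A subset_rfl, key⟩
  · intro x hx y hy hxy
    obtain ⟨a, ha, rfl⟩ := Finset.mem_image.1 (Finset.mem_coe.1 hx)
    obtain ⟨b, hb, rfl⟩ := Finset.mem_image.1 (Finset.mem_coe.1 hy)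
    rw [key a ha, key b hb] at hxy
    rw [hxy]
  · intro e he
    obtain ⟨u, hu, rfl⟩ := Finset.subset_image_iff.1 he
    have hu : u ⊆ A := by exact_mod_cast hu
    rw [himg u hu, h.edges_iff u hu]

/-- Given a strong extension `A ⊆ B` of which the base is embedded in a strong set `E`, the part
`B \ A` can be copied outside `E`, freely over `E` except that the copy of `q` forms prescribed
additional hyperedges with the sets in `L`. -/
lemma IsHrushovskiGeneric.exists_linked_partialIso (hs : s ≠ 0) (hη : 0 ≤ η)
    (hH : H.IsHrushovskiGeneric η)
    {A B E : Finset V} (hAB : A ⊆ B) {ψ₀ : V → V} (hψ₀ : H.IsPartialIso A ψ₀)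
    (hAE : A.image ψ₀ ⊆ E) (hE : H.Strong η E) {q : V} (hqB : q ∈ B) (hqA : q ∉ A)
    (L : Finset (Finset V)) (hLE : ∀ ℓ ∈ L, ℓ ⊆ E) (hLc : ∀ ℓ ∈ L, ℓ.card + 1 = s)
    (hLA : ∀ ℓ ∈ L, ¬ ℓ ⊆ A.image ψ₀)
    (hδ : ∀ X, A ⊆ X → X ⊆ B →
      H.predim η A + η * (if q ∈ X then (L.card : ℝ) else 0) ≤ H.predim η X) :
    ∃ ψ : V → V, (∀ a ∈ A, ψ a = ψ₀ a) ∧ (∀ b ∈ B, b ∉ A → ψ b ∉ E) ∧ H.IsPartialIso B ψ ∧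
      H.Strong η (E ∪ B.image ψ) ∧
      (∀ e ∈ H.edges, e ⊆ E ∪ B.image ψ →
        e ⊆ E ∨ e ⊆ B.image ψ ∨ ∃ ℓ ∈ L, e = insert (ψ q) ℓ) ∧
      ∀ ℓ ∈ L, insert (ψ q) ℓ ∈ H.edges := by
  let ι := {x // x ∈ B \ A}
  let τ : V → V ⊕ ι := fun v => if h : v ∈ B \ A then Sum.inr ⟨v, h⟩ else Sum.inl (ψ₀ v)
  have τA : ∀ v ∈ A, τ v = Sum.inl (ψ₀ v) := fun v hv => dif_neg (by simp [hv])
  have τB : ∀ v (h : v ∈ B \ A), τ v = Sum.inr ⟨v, h⟩ := fun v hv => dif_pos hv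
  have hτ : Set.InjOn τ (B : Set V) := by
    intro u hu v hv huv
    have hu : u ∈ B := hu
    have hv : v ∈ B := hv
    by_cases hu' : u ∈ A <;> by_cases hv' : v ∈ A
    · rw [τA u hu', τA v hv'] at huv
      exact hψ₀.injOn hu' hv' (Sum.inl_injective huv)
    · rw [τA u hu', τB v (by simp [*])] at huv
      simp at huv
    · rw [τB u (by simp [*]), τA v hv'] at huv
      simp at huv
    · rw [τB u (by simp [*]), τB v (by simp [*])] at huv
      exact congrArg Subtype.val (Sum.inr_injective huv)
  have hqι : q ∈ B \ A := by simp [hqB, hqA]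
  let lk : Finset V → Finset (V ⊕ ι) :=
    fun ℓ => insert (Sum.inr ⟨q, hqι⟩) (ℓ.map Function.Embedding.inl)
  -- The new hyperedges: those of `B` not inside `A`, transported by `τ`, and the links from `q` to
  -- `L`.
  let 𝓕 : Finset (Finset (V ⊕ ι)) :=
    ((H.edgesIn B).filter (fun e => ¬ e ⊆ A)).image (·.image τ) ∪ L.image lk
  have mem𝓕 : ∀ e, e ∈ 𝓕 ↔ (∃ e₀, e₀ ⊆ B ∧ e₀ ∈ H.edges ∧ ¬ e₀ ⊆ A ∧ e₀.image τ = e) ∨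
      ∃ ℓ ∈ L, lk ℓ = e := by
    intro e
    simp [𝓕, mem_edgesIn, and_assoc]
  have hright : ∀ e ⊆ B, ∀ i : ι, i ∈ (e.image τ).toRight ↔ (i : V) ∈ e := by
    intro e he i
    rw [Finset.mem_toRight, ← τB i i.2]
    constructor
    · intro h
      obtain ⟨v, hv, hvi⟩ := Finset.mem_image.1 h
      rwa [← hτ (he hv) (Finset.mem_sdiff.1 i.2).1 hvi]
    · exact fun h => Finset.mem_image_of_mem _ h
  have hrightne : ∀ e ⊆ B, ¬ e ⊆ A → (e.image τ).toRight.Nonempty := by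
    intro e he heA
    obtain ⟨v, hv, hvA⟩ := Finset.not_subset.1 heA
    exact ⟨⟨v, by simp [he hv, hvA]⟩, (hright e he _).2 hv⟩
  have hleft : ∀ e ⊆ B, (e.image τ).toLeft ⊆ A.image ψ₀ := by
    intro e he v hv
    obtain ⟨u, hu, huv⟩ := Finset.mem_image.1 (Finset.mem_toLeft.1 hv)
    by_cases huA : u ∈ A
    · rw [τA u huA] at huv
      rw [← Sum.inl_injective huv]
      exact Finset.mem_image_of_mem _ huA
    · rw [τB u (by simp [huA, he hu])] at huv
      simp at huv
  have lkleft : ∀ ℓ, (lk ℓ).toLeft = ℓ := by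
    intro ℓ; ext v; simp [lk]
  obtain ⟨z, hzE, hzS, hzF⟩ := hH.exists_extension (ι := ι) hs hE 𝓕
    (by
      intro e he
      rcases (mem𝓕 e).1 he with ⟨e₀, h1, h2, -, rfl⟩ | ⟨ℓ, hℓ, rfl⟩
      · rw [Finset.card_image_of_injOn (hτ.mono (by exact_mod_cast h1)), H.card_eq _ h2]
      · rw [Finset.card_insert_of_notMem (by simp), Finset.card_map, hLc ℓ hℓ])
    (by
      intro e he
      rcases (mem𝓕 e).1 he with ⟨e₀, h1, -, h3, rfl⟩ | ⟨ℓ, hℓ, rfl⟩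
      · exact hrightne _ h1 h3
      · exact ⟨⟨q, hqι⟩, by simp [lk]⟩)
    (by
      intro I
      let I' : Finset V := I.map (Function.Embedding.subtype _)
      have hI'B : I' ⊆ B := by
        intro v hv
        obtain ⟨i, -, rfl⟩ := Finset.mem_map.1 hv
        exact (Finset.mem_sdiff.1 i.2).1
      have hI'A : Disjoint A I' := by
        rw [Finset.disjoint_right]
        intro v hv
        obtain ⟨i, -, rfl⟩ := Finset.mem_map.1 hv
        exact (Finset.mem_sdiff.1 i.2).2
      -- The new hyperedges whose new vertices lie in `I` come from hyperedges inside `A ∪ I'` but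
      -- not inside `A`, or are links when `q` is in `I`. The assumption on `A ∪ I'` pays for
      -- exactly these.
      have hX := hδ (A ∪ I') Finset.subset_union_left (Finset.union_subset hAB hI'B)
      have hqI : q ∈ A ∪ I' ↔ (⟨q, hqι⟩ : ι) ∈ I := by
        simp [I', hqA, hqB]
      let N := (H.edgesIn (A ∪ I')).filter (fun e => ¬ e ⊆ A)
      have hN : (H.edgesIn (A ∪ I')).card = (H.edgesIn A).card + N.card := by
        rw [← Finset.card_filter_add_card_filter_not (s := H.edgesIn (A ∪ I')) (fun e => e ⊆ A)]
        congr 2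
        ext e
        simp only [Finset.mem_filter, mem_edgesIn]
        constructor
        · exact fun h => ⟨h.2, h.1.2⟩
        · exact fun h => ⟨⟨h.1.trans Finset.subset_union_left, h.2⟩, h.1⟩
      have hsub : 𝓕.filter (fun e => e.toRight ⊆ I) ⊆
          N.image (·.image τ) ∪ (if (⟨q, hqι⟩ : ι) ∈ I then L.image lk else ∅) := by
        intro e he
        obtain ⟨he, heI⟩ := Finset.mem_filter.1 he
        rw [Finset.mem_union]
        rcases (mem𝓕 e).1 he with ⟨e₀, h1, h2, h3, rfl⟩ | ⟨ℓ, hℓ, rfl⟩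
        · left
          refine Finset.mem_image.2 ⟨e₀, Finset.mem_filter.2 ⟨mem_edgesIn.2 ⟨?_, h2⟩, h3⟩, rfl⟩
          intro v hv
          by_cases hvA : v ∈ A
          · exact Finset.mem_union_left _ hvA
          · refine Finset.mem_union_right _ (Finset.mem_map.2 ⟨⟨v, by simp [h1 hv, hvA]⟩, ?_, rfl⟩)
            exact heI ((hright _ h1 _).2 hv)
        · right
          rw [if_pos (heI (by simp [lk]))]
          exact Finset.mem_image_of_mem _ hℓ
      have hcard : ((𝓕.filter (fun e => e.toRight ⊆ I)).card : ℝ) ≤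
          N.card + if q ∈ A ∪ I' then (L.card : ℝ) else 0 := by
        have h1 := (Finset.card_le_card hsub).trans (Finset.card_union_le _ _)
        have h2 : (N.image (·.image τ)).card ≤ N.card := Finset.card_image_le
        have h3 : (L.image lk).card ≤ L.card := Finset.card_image_le
        by_cases hq : (⟨q, hqι⟩ : ι) ∈ I
        · rw [if_pos (hqI.2 hq)]
          rw [if_pos hq] at h1
          exact_mod_cast h1.trans (by omega)
        · rw [if_neg (fun h => hq (hqI.1 h))]
          rw [if_neg hq, Finset.card_empty] at h1
          have : (𝓕.filter (fun e => e.toRight ⊆ I)).card ≤ N.card := by omega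
          simpa using this
      have h5 := mul_le_mul_of_nonneg_left hcard hη
      simp only [predim] at hX
      rw [Finset.card_union_of_disjoint hI'A, hN] at hX
      push_cast at hX
      have : (I'.card : ℝ) = I.card := by simp [I']
      rw [mul_add] at h5
      have h6 : η * ((𝓕.filter (fun e => e.toRight ⊆ I)).card : ℝ) ≤ I.card := by linarith
      convert h6) hη
  let ψ : V → V := fun v => Sum.elim id z (τ v)
  have ψA : ∀ a ∈ A, ψ a = ψ₀ a := fun a ha => by simp [ψ, τA a ha]
  have ψB : ∀ b (h : b ∈ B \ A), ψ b = z ⟨b, h⟩ := fun b hb => by simp [ψ, τB b hb]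
  have ψim : ∀ e : Finset V, e.image ψ = (e.image τ).image (Sum.elim id z) := fun e => by
    rw [Finset.image_image]; rfl
  have ψE : ∀ a ∈ A, ψ a ∈ E := fun a ha => by
    rw [ψA a ha]; exact hAE (Finset.mem_image_of_mem _ ha)
  have ψE' : ∀ b ∈ B, b ∉ A → ψ b ∉ E := fun b hb hbA => by
    rw [ψB b (by simp [*])]; exact hzE _
  have himg : E ∪ B.image ψ = E ∪ Finset.univ.map z := by
    ext v
    simp only [Finset.mem_union, Finset.mem_image, Finset.mem_map, Finset.mem_univ, true_and]
    constructor
    · rintro (h | ⟨b, hb, rfl⟩)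
      · exact Or.inl h
      · by_cases hbA : b ∈ A
        · exact Or.inl (ψE b hbA)
        · exact Or.inr ⟨_, (ψB b (by simp [*])).symm⟩
    · rintro (h | ⟨b, rfl⟩)
      · exact Or.inl h
      · exact Or.inr ⟨b, (Finset.mem_sdiff.1 b.2).1, ψB b b.2⟩
  refine ⟨ψ, ψA, ψE', ⟨?_, ?_⟩, ?_, ?_, ?_⟩
  · intro u hu v hv huv
    have hu : u ∈ B := hu
    have hv : v ∈ B := hv
    by_cases hu' : u ∈ A <;> by_cases hv' : v ∈ A
    · rw [ψA u hu', ψA v hv'] at huv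
      exact hψ₀.injOn hu' hv' huv
    · exact absurd (huv ▸ ψE u hu') (ψE' v hv hv')
    · exact absurd (huv ▸ ψE v hv') (ψE' u hu hu')
    · rw [ψB u (by simp [*]), ψB v (by simp [*])] at huv
      exact congrArg Subtype.val (z.injective huv)
  · intro e he
    by_cases heA : e ⊆ A
    · rw [Finset.image_congr (g := ψ₀) (fun a ha => ψA a (heA ha))]
      exact hψ₀.edges_iff e heA
    · rw [ψim, hzF _ ((hleft e he).trans hAE) (hrightne e he heA), mem𝓕]
      constructor
      · rintro (⟨e₀, h1, h2, -, h4⟩ | ⟨ℓ, hℓ, h⟩)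
        · rwa [← eq_of_image_eq_of_injOn hτ h1 he h4]
        -- A link is never the image of a subset of `B`, because the old part of such an image lies
        -- in the copy of `A`.
        · refine absurd ?_ (hLA ℓ hℓ)
          rw [← lkleft ℓ, h]
          exact hleft e he
      · exact fun h => Or.inl ⟨e, he, h, heA, rfl⟩
  · rw [himg]
    exact hzS
  · intro e he heE
    by_cases heE' : e ⊆ E
    · exact Or.inl heE'
    right
    let e' : Finset (V ⊕ ι) := (e ∩ E).disjSum (Finset.univ.filter (fun i => z i ∈ e))
    have h1 : e'.image (Sum.elim id z) = e := by
      ext v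
      simp only [Finset.mem_image]
      constructor
      · rintro ⟨(u | i), hu, rfl⟩
        · exact (Finset.mem_inter.1 (Finset.inl_mem_disjSum.1 hu)).1
        · exact (Finset.mem_filter.1 (Finset.inr_mem_disjSum.1 hu)).2
      · intro hv
        by_cases hvE : v ∈ E
        · exact ⟨Sum.inl v, by simp [e', hv, hvE], rfl⟩
        · have := heE hv
          rw [himg, Finset.mem_union, Finset.mem_map] at this
          obtain ⟨i, -, rfl⟩ := this.resolve_left hvE
          exact ⟨Sum.inr i, by simp [e', hv], rfl⟩
    have h2 : e'.toRight.Nonempty := by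
      obtain ⟨v, hv, hvE⟩ := Finset.not_subset.1 heE'
      have := heE hv
      rw [himg, Finset.mem_union, Finset.mem_map] at this
      obtain ⟨i, -, rfl⟩ := this.resolve_left hvE
      exact ⟨i, by simp [e', hv]⟩
    have h3 : e' ∈ 𝓕 := by
      rw [← hzF e' (by simp [e']) h2, h1]
      exact he
    rcases (mem𝓕 _).1 h3 with ⟨e₀, h4, -, -, h5⟩ | ⟨ℓ, hℓ, h⟩
    · left
      rw [← h1, ← h5, ← ψim]
      exact Finset.image_subset_image h4
    · right
      refine ⟨ℓ, hℓ, ?_⟩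
      rw [← h1, ← h]
      simp only [lk, Finset.image_insert, Sum.elim_inr, ψB q hqι]
      congr 1
      ext v
      simp
  · intro ℓ hℓ
    have h1 := (hzF (lk ℓ) (by rw [lkleft]; exact hLE ℓ hℓ) ⟨⟨q, hqι⟩, by simp [lk]⟩).2
      ((mem𝓕 _).2 (Or.inr ⟨ℓ, hℓ, rfl⟩))
    convert h1 using 1
    simp only [lk, Finset.image_insert, Sum.elim_inr, ψB q hqι]
    congr 1
    ext v
    simp

/-- A partial isomorphism between finite strong sets. -/
structure StrongPartialIso (η : ℝ) (H : UniformHypergraph s V) where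
  /-- The domain. -/
  dom : Finset V
  /-- The map; only its values on the domain matter. -/
  toFun : V → V
  isPartialIso : H.IsPartialIso dom toFun
  strong_dom : H.Strong η dom
  strong_image : H.Strong η (dom.image toFun)

/-- Not antisymmetric: two maps may agree on a common domain and differ off it. -/
instance : Preorder (StrongPartialIso η H) where
  le p q := p.dom ⊆ q.dom ∧ ∀ a ∈ p.dom, q.toFun a = p.toFun a
  le_refl p := ⟨subset_rfl, fun _ _ => rfl⟩
  le_trans p q r h h' := ⟨h.1.trans h'.1, fun a ha => (h'.2 a (h.1 ha)).trans (h.2 a ha)⟩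

/-- The forth step: a strong set around the domain and `v` is copied freely over the image, that is,
with no links. -/
lemma IsHrushovskiGeneric.exists_le_mem_dom (hs : s ≠ 0) (hη : 0 ≤ η)
    (hH : H.IsHrushovskiGeneric η) (p : StrongPartialIso η H) (v : V) :
    ∃ q, p ≤ q ∧ v ∈ q.dom := by
  by_cases hv : v ∈ p.dom
  · exact ⟨p, le_rfl, hv⟩
  obtain ⟨B, hB, hBs⟩ := hH.exists_strong (insert v p.dom)
  rw [Finset.insert_subset_iff] at hB
  obtain ⟨ψ, h1, -, h3, h4, -⟩ := hH.exists_linked_partialIso hs hη hB.2 p.isPartialIso subset_rfl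
    p.strong_image hB.1 hv ∅ (by simp) (by simp) (by simp)
    (fun X hX _ => by simpa using strong_iff.1 p.strong_dom X hX)
  refine ⟨⟨B, ψ, h3, hBs, ?_⟩, ⟨hB.2, h1⟩, hB.1⟩
  rwa [Finset.union_eq_right.2] at h4
  rw [← Finset.image_congr (f := ψ) (fun a ha => h1 a ha)]
  exact Finset.image_subset_image hB.2

/-- The inverse of a strong partial isomorphism. -/
noncomputable def StrongPartialIso.symm [Nonempty V] (p : StrongPartialIso η H) :
    StrongPartialIso η H where
  dom := p.dom.image p.toFun
  toFun := Function.invFunOn p.toFun (p.dom : Set V)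
  isPartialIso := p.isPartialIso.inv.1
  strong_dom := p.strong_image
  strong_image := by rw [p.isPartialIso.inv.2.1]; exact p.strong_dom

lemma IsHrushovskiGeneric.exists_le_mem_image (hs : s ≠ 0) (hη : 0 ≤ η)
    (hH : H.IsHrushovskiGeneric η) (p : StrongPartialIso η H) (v : V) :
    ∃ q, p ≤ q ∧ v ∈ q.dom.image q.toFun := by
  have : Nonempty V := ⟨v⟩
  obtain ⟨q, hpq, hv⟩ := hH.exists_le_mem_dom hs hη p.symm v
  have hp := p.isPartialIso.inv.2.2
  have hq := q.isPartialIso.inv.2.2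
  have hpa : ∀ a ∈ p.dom, p.toFun a ∈ q.dom ∧ q.toFun (p.toFun a) = a := by
    intro a ha
    have h1 : p.toFun a ∈ p.symm.dom := Finset.mem_image_of_mem _ ha
    exact ⟨hpq.1 h1, (hpq.2 _ h1).trans (hp a ha)⟩
  refine ⟨q.symm, ⟨fun a ha => ?_, fun a ha => ?_⟩, ?_⟩
  · obtain ⟨h1, h2⟩ := hpa a ha
    exact Finset.mem_image.2 ⟨_, h1, h2⟩
  · obtain ⟨h1, h2⟩ := hpa a ha
    have := hq _ h1
    rw [h2] at this
    exact this
  · change v ∈ (q.dom.image q.toFun).image (Function.invFunOn q.toFun (q.dom : Set V))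
    rw [q.isPartialIso.inv.2.1]
    exact hv

/-- Homogeneity: isomorphisms between finite strong sets extend to automorphisms. -/
lemma IsHrushovskiGeneric.exists_aut (hs : s ≠ 0) (hη : 0 ≤ η)
    (hH : H.IsHrushovskiGeneric η) {A : Finset V} {ψ : V → V} (hψ : H.IsPartialIso A ψ)
    (hA : H.Strong η A) (hA' : H.Strong η (A.image ψ)) :
    ∃ y : H.Aut, ∀ a ∈ A, y • a = ψ a := by
  have := hH.countable
  let _ : Encodable V := Encodable.ofCountable V
  -- Back-and-forth as a generic sequence: one cofinal family per vertex for the domain and one for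
  -- the image.
  let 𝒟 : V ⊕ V → Order.Cofinal (StrongPartialIso η H) := Sum.elim
    (fun v => ⟨{p | v ∈ p.dom}, fun p => by
      obtain ⟨q, h1, h2⟩ := hH.exists_le_mem_dom hs hη p v
      exact ⟨q, h2, h1⟩⟩)
    (fun v => ⟨{p | v ∈ p.dom.image p.toFun}, fun p => by
      obtain ⟨q, h1, h2⟩ := hH.exists_le_mem_image hs hη p v
      exact ⟨q, h2, h1⟩⟩)
  let p₀ : StrongPartialIso η H := ⟨A, ψ, hψ, hA, hA'⟩
  let f := Order.sequenceOfCofinals p₀ 𝒟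
  have hmono : Monotone f := Order.sequenceOfCofinals.monotone _ _
  let N : V → ℕ := fun v => Encodable.encode (Sum.inl v : V ⊕ V) + 1
  have hN : ∀ v, v ∈ (f (N v)).dom := fun v =>
    Order.sequenceOfCofinals.encode_mem p₀ 𝒟 (Sum.inl v)
  have hN' : ∀ v, ∃ n, v ∈ (f n).dom.image (f n).toFun := fun v =>
    ⟨_, Order.sequenceOfCofinals.encode_mem p₀ 𝒟 (Sum.inr v)⟩
  let y : V → V := fun v => (f (N v)).toFun v
  have hy : ∀ n, ∀ v ∈ (f n).dom, (f n).toFun v = y v := by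
    intro n v hv
    have h1 := (hmono (le_max_left n (N v))).2 v hv
    have h2 := (hmono (le_max_right n (N v))).2 v (hN v)
    exact h1.symm.trans h2
  have hfin : ∀ X : Finset V, ∃ n, X ⊆ (f n).dom := fun X =>
    ⟨X.sup N, fun v hv => (hmono (Finset.le_sup hv)).1 (hN v)⟩
  have hinj : Function.Injective y := by
    intro u v huv
    obtain ⟨n, hn⟩ := hfin {u, v}
    have hu : u ∈ (f n).dom := hn (by simp)
    have hv : v ∈ (f n).dom := hn (by simp)
    rw [← hy n u hu, ← hy n v hv] at huv
    exact (f n).isPartialIso.injOn hu hv huv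
  have hsurj : Function.Surjective y := by
    intro v
    obtain ⟨n, hn⟩ := hN' v
    obtain ⟨u, hu, rfl⟩ := Finset.mem_image.1 hn
    exact ⟨u, (hy n u hu).symm⟩
  let σ : Equiv.Perm V := Equiv.ofBijective y ⟨hinj, hsurj⟩
  refine ⟨⟨σ, ?_⟩, ?_⟩
  · intro e
    obtain ⟨n, hn⟩ := hfin e
    rw [← (f n).isPartialIso.edges_iff e hn, Finset.map_eq_image]
    have h1 : e.image σ = e.image (f n).toFun :=
      Finset.image_congr fun a ha => (hy n a (hn ha)).symm
    exact iff_of_eq (congrArg (· ∈ H.edges) h1)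
  · intro a ha
    exact (hy 0 a ha).symm

end PartialIso

end UniformHypergraph

namespace UniformHypergraph

/-! ### Linked copies realized by automorphisms. -/

section LinkedCopy

open Classical
open scoped Pointwise

variable {s : ℕ} {V : Type*} {η : ℝ} {H : UniformHypergraph s V}

lemma smul_finset_eq_map (g : H.Aut) (X : Finset V) :
    g • X = X.map (g : Equiv.Perm V).toEmbedding := by
  rw [Finset.map_eq_image]
  rfl

lemma smul_mem_edges_iff (g : H.Aut) (e : Finset V) : g • e ∈ H.edges ↔ e ∈ H.edges := by
  rw [smul_finset_eq_map]
  exact g.2 e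

lemma predim_smul (g : H.Aut) (X : Finset V) : H.predim η (g • X) = H.predim η X := by
  rw [smul_finset_eq_map]
  exact IsEmbedding.predim_map g.2 X

lemma Strong.smul {A : Finset V} (hA : H.Strong η A) (g : H.Aut) : H.Strong η (g • A) := by
  rw [strong_iff] at hA ⊢
  intro X hX
  rw [predim_smul, ← predim_smul g⁻¹ X]
  exact hA _ (Finset.smul_finset_subset_iff.1 hX)

/-- The automorphism `y` moves `B` over `A` to a copy outside `E`, free over `E` except for the
hyperedges `insert (y • q) ℓ` with `ℓ ∈ L`. -/
structure IsLinkedCopy (η : ℝ) (H : UniformHypergraph s V) (A B E : Finset V) (q : V)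
    (L : Finset (Finset V)) (y : H.Aut) : Prop where
  subset_left : A ⊆ B
  subset_right : A ⊆ E
  mem : q ∈ B
  notMem : q ∉ A
  link_subset : ∀ ℓ ∈ L, ℓ ⊆ E
  link_not_subset : ∀ ℓ ∈ L, ¬ ℓ ⊆ A
  smul_eq : ∀ a ∈ A, y • a = a
  smul_notMem : ∀ b ∈ B, b ∉ A → y • b ∉ E
  strong : H.Strong η (E ∪ y • B)
  edges : ∀ e ∈ H.edges, e ⊆ E ∪ y • B → e ⊆ E ∨ e ⊆ y • B ∨ ∃ ℓ ∈ L, e = insert (y • q) ℓ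
  link_mem : ∀ ℓ ∈ L, insert (y • q) ℓ ∈ H.edges

/-- There are two budgets. `hδ` says that `B` over `A` can afford the links, which keeps the union
with `E` strong. `hL` says that the linked blocks cost at least `η` each over `A`, which keeps the
copy itself strong, so that homogeneity yields an automorphism. -/
lemma IsHrushovskiGeneric.exists_isLinkedCopy (hs : s ≠ 0) (hη : 0 < η)
    (hH : H.IsHrushovskiGeneric η) {A B E : Finset V} (hAB : A ⊆ B) (hB : H.Strong η B)
    (hAE : A ⊆ E) (hE : H.Strong η E) {q : V} (hqB : q ∈ B) (hqA : q ∉ A)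
    (L : Finset (Finset V)) (hLE : ∀ ℓ ∈ L, ℓ ⊆ E) (hLc : ∀ ℓ ∈ L, ℓ.card + 1 = s)
    (hδ : ∀ X, A ⊆ X → X ⊆ B →
      H.predim η A + η * (if q ∈ X then (L.card : ℝ) else 0) ≤ H.predim η X)
    (hL : ∀ X, A ⊆ X → X ⊆ E →
      H.predim η A + η * ((L.filter (· ⊆ X)).card : ℝ) ≤ H.predim η X) :
    ∃ y : H.Aut, IsLinkedCopy η H A B E q L y := by
  have hLA : ∀ ℓ ∈ L, ¬ ℓ ⊆ A := by
    intro ℓ hℓ h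
    have h1 := hL A subset_rfl hAE
    have h2 : 0 < (L.filter (· ⊆ A)).card := Finset.card_pos.2 ⟨ℓ, by simp [hℓ, h]⟩
    have h3 : 0 < η * ((L.filter (· ⊆ A)).card : ℝ) := by positivity
    linarith
  have hid : H.IsPartialIso A id := ⟨Set.injOn_id _, fun e _ => by rw [Finset.image_id]⟩
  obtain ⟨ψ, h1, h2, h3, h4, h5, h6⟩ := hH.exists_linked_partialIso hs hη.le hAB hid
    (by rwa [Finset.image_id]) hE hqB hqA L hLE hLc (by rwa [Finset.image_id]) hδ
  have hEB : E ∩ B.image ψ = A := by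
    ext v
    simp only [Finset.mem_inter, Finset.mem_image]
    constructor
    · rintro ⟨hv, b, hb, rfl⟩
      by_cases hbA : b ∈ A
      · rwa [h1 b hbA]
      · exact absurd hv (h2 b hb hbA)
    · exact fun hv => ⟨hAE hv, v, hAB hv, h1 v hv⟩
  have hstrong : H.Strong η (B.image ψ) := by
    rw [strong_iff]
    intro X hX
    refine le_trans ?_ (h4.predim_inter_le hη.le X)
    set X' := X ∩ (E ∪ B.image ψ) with hX'
    have hBX' : B.image ψ ⊆ X' := Finset.subset_inter hX Finset.subset_union_right
    have h7 := predim_union_add_inter η H (X' ∩ E) (B.image ψ)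
    have h8 : X' ∩ E ∪ B.image ψ = X' := by
      rw [Finset.inter_union_distrib_right, Finset.union_eq_left.2 hBX', hX']
      exact Finset.inter_eq_left.2 Finset.inter_subset_right
    have h9 : X' ∩ E ∩ B.image ψ = A := by
      rw [Finset.inter_assoc, hEB]
      exact Finset.inter_eq_right.2 ((hEB.symm.subset.trans Finset.inter_subset_right).trans hBX')
    -- Only links cross between `E` and the copy, and their saving is offset by the dimension of the
    -- blocks contained in `X'`.
    have h10 : H.crossEdges (X' ∩ E) (B.image ψ) ⊆
        (L.filter (· ⊆ X' ∩ E)).image (insert (ψ q)) := by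
      intro e he
      rw [mem_crossEdges, h8] at he
      obtain ⟨he1, he2, he3, he4⟩ := he
      rcases h5 e he2 (he1.trans Finset.inter_subset_right) with h | h | ⟨ℓ, hℓ, rfl⟩
      · exact absurd (Finset.subset_inter he1 h) he3
      · exact absurd h he4
      · refine Finset.mem_image.2 ⟨ℓ, Finset.mem_filter.2 ⟨hℓ, ?_⟩, rfl⟩
        exact Finset.subset_inter ((Finset.subset_insert _ _).trans he1) (hLE ℓ hℓ)
    have h11 : (H.crossEdges (X' ∩ E) (B.image ψ)).card ≤ (L.filter (· ⊆ X' ∩ E)).card :=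
      (Finset.card_le_card h10).trans Finset.card_image_le
    have h12 : η * ((H.crossEdges (X' ∩ E) (B.image ψ)).card : ℝ) ≤
        η * (L.filter (· ⊆ X' ∩ E)).card := by gcongr
    have h13 := hL (X' ∩ E) (Finset.subset_inter
      ((hEB.symm.subset.trans Finset.inter_subset_right).trans hBX') hAE) Finset.inter_subset_right
    rw [h8, h9] at h7
    linarith
  obtain ⟨y, hy⟩ := hH.exists_aut hs hη.le h3 hB hstrong
  have hyB : y • B = B.image ψ := Finset.image_congr hy
  refine ⟨y, hAB, hAE, hqB, hqA, hLE, hLA, fun a ha => (hy a (hAB ha)).trans (h1 a ha), ?_, ?_, ?_,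
    ?_⟩
  · intro b hb hbA
    rw [hy b hb]
    exact h2 b hb hbA
  · rwa [hyB]
  · rwa [hyB, hy q hqB]
  · rwa [hy q hqB]

variable {A B E : Finset V} {q : V} {L : Finset (Finset V)} {y : H.Aut}

lemma IsLinkedCopy.smul_base (h : IsLinkedCopy η H A B E q L y) : y • A = A := by
  conv_rhs => rw [← Finset.image_id (s := A)]
  exact Finset.image_congr h.smul_eq

lemma IsLinkedCopy.base_subset (h : IsLinkedCopy η H A B E q L y) : A ⊆ y • B := by
  rw [← h.smul_base]
  exact Finset.smul_finset_subset_smul_finset h.subset_left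

lemma IsLinkedCopy.inter_eq (h : IsLinkedCopy η H A B E q L y) : E ∩ y • B = A := by
  ext v
  simp only [Finset.mem_inter, Finset.mem_smul_finset]
  constructor
  · rintro ⟨hv, b, hb, rfl⟩
    by_cases hbA : b ∈ A
    · rwa [h.smul_eq b hbA]
    · exact absurd hv (h.smul_notMem b hb hbA)
  · exact fun hv => ⟨h.subset_right hv, v, h.subset_left hv, h.smul_eq v hv⟩

/-- The predimension of a subset of a linked copy. -/
lemma IsLinkedCopy.predim_eq (h : IsLinkedCopy η H A B E q L y) {X : Finset V}
    (hX : X ⊆ E ∪ y • B) :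
    H.predim η X = H.predim η (X ∩ E) + H.predim η (X ∩ y • B) - H.predim η (X ∩ A) -
      η * (if y • q ∈ X then ((L.filter (· ⊆ X)).card : ℝ) else 0) := by
  have h1 := predim_union_add_inter η H (X ∩ E) (X ∩ y • B)
  have h2 : X ∩ E ∪ X ∩ y • B = X := by
    rw [← Finset.inter_union_distrib_left, Finset.inter_eq_left.2 hX]
  have h3 : X ∩ E ∩ (X ∩ y • B) = X ∩ A := by
    rw [← Finset.inter_inter_distrib_left, h.inter_eq]
  have hq := h.smul_notMem q h.mem h.notMem
  have h4 : H.crossEdges (X ∩ E) (X ∩ y • B) =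
      if y • q ∈ X then (L.filter (· ⊆ X)).image (insert (y • q)) else ∅ := by
    ext e
    rw [mem_crossEdges, h2]
    constructor
    · rintro ⟨he1, he2, he3, he4⟩
      rcases h.edges e he2 (he1.trans hX) with h5 | h5 | ⟨ℓ, hℓ, rfl⟩
      · exact absurd (Finset.subset_inter he1 h5) he3
      · exact absurd (Finset.subset_inter he1 h5) he4
      · rw [if_pos (he1 (Finset.mem_insert_self _ _))]
        exact Finset.mem_image.2 ⟨ℓ, Finset.mem_filter.2
          ⟨hℓ, (Finset.subset_insert _ _).trans he1⟩, rfl⟩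
    · intro he
      split_ifs at he with hqX
      · obtain ⟨ℓ, hℓ, rfl⟩ := Finset.mem_image.1 he
        obtain ⟨hℓ, hℓX⟩ := Finset.mem_filter.1 hℓ
        refine ⟨Finset.insert_subset hqX hℓX, h.link_mem ℓ hℓ, fun h5 => ?_, fun h5 => ?_⟩
        · exact hq (Finset.mem_inter.1 (h5 (Finset.mem_insert_self _ _))).2
        · refine h.link_not_subset ℓ hℓ ?_
          rw [← h.inter_eq]
          exact Finset.subset_inter (h.link_subset ℓ hℓ) (((Finset.subset_insert _ _).trans h5).trans
            Finset.inter_subset_right)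
      · simp at he
  have h5 : ((H.crossEdges (X ∩ E) (X ∩ y • B)).card : ℝ) =
      if y • q ∈ X then ((L.filter (· ⊆ X)).card : ℝ) else 0 := by
    rw [h4]
    split_ifs
    · rw [Finset.card_image_of_injOn]
      intro ℓ hℓ ℓ' hℓ' hll
      have h6 : ∀ m ∈ L.filter (· ⊆ X), y • q ∉ m := fun m hm hqm =>
        hq (h.link_subset m (Finset.mem_filter.1 hm).1 hqm)
      have := congrArg (Finset.erase · (y • q)) hll
      simpa [Finset.erase_insert (h6 ℓ hℓ), Finset.erase_insert (h6 ℓ' hℓ')] using this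
    · simp
  rw [h2, h3, h5] at h1
  linarith

end LinkedCopy

end UniformHypergraph

namespace UniformHypergraph

/-! ### Vertices and blocks moved independently by a nontrivial automorphism. -/

section Blocks

open Classical
open scoped Pointwise

variable {s : ℕ} {V : Type*} {η : ℝ} {H : UniformHypergraph s V}

/-- If `g` moves a vertex of relative dimension at least `t` over `D`, it moves one of relative
dimension at least `min 1 (t + (s - 1) - η)`. -/
lemma IsHrushovskiGeneric.exists_moved_of_moved (hs : 2 ≤ s) (hη₀ : 0 ≤ η) (hη₁ : η ≤ 1)
    (hH : H.IsHrushovskiGeneric η) (g : H.Aut) {D : Finset V} {a : V}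
    (ha : g • a ≠ a) {t : ℝ} (ht : ∀ C, D ⊆ C → a ∈ C → H.predim η D + t ≤ H.predim η C)
    (hD : H.Strong η D) :
    ∃ r, g • r ≠ r ∧ ∀ C, D ⊆ C → r ∈ C →
      H.predim η D + min 1 (t + ((s : ℝ) - 1 - η)) ≤ H.predim η C := by
  obtain ⟨E, hDE, hE⟩ := hH.exists_strong (insert a (insert (g • a) D))
  simp only [Finset.insert_subset_iff] at hDE
  obtain ⟨haE, hgaE, hDE⟩ := hDE
  let N : V → Finset (V ⊕ Fin (s - 1)) :=
    fun v => insert (Sum.inl v) (Finset.univ.map Function.Embedding.inr)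
  have hNl : ∀ v, (N v).toLeft = {v} := by intro v; ext; simp [N]
  have hNr : ∀ v, (N v).toRight = Finset.univ := by intro v; ext; simp [N]
  have i₀ : Fin (s - 1) := ⟨0, by omega⟩
  have hs1 : ((s - 1 : ℕ) : ℝ) = (s : ℝ) - 1 := by
    rw [Nat.cast_sub (by omega)]; simp
  obtain ⟨z, hzE, hzS, hzF⟩ := hH.exists_extension (ι := Fin (s - 1)) (by omega) hE {N a}
    (by
      intro e he
      rw [Finset.mem_singleton.1 he, Finset.card_insert_of_notMem (by simp), Finset.card_map,
        Finset.card_univ, Fintype.card_fin]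
      omega)
    (by
      intro e he
      rw [Finset.mem_singleton.1 he, hNr]
      exact ⟨i₀, Finset.mem_univ _⟩)
    (by
      intro I
      rw [Finset.filter_singleton, hNr]
      split_ifs with h
      · rw [Finset.univ_subset_iff.1 h, Finset.card_univ, Fintype.card_fin, hs1]
        have : (2 : ℝ) ≤ s := by exact_mod_cast hs
        simp only [Finset.card_singleton, Nat.cast_one, mul_one]
        linarith
      · simp) hη₀
  set R := Finset.univ.map z with hR
  have hNim : ∀ v, (N v).image (Sum.elim id z) = insert v R := by
    intro v
    simp only [N, Finset.image_insert, Sum.elim_inl, id]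
    congr 1
    ext v
    simp [hR]
  have hNmem : ∀ v ∈ E, insert v R ∈ H.edges ↔ v = a := by
    intro v hv
    rw [← hNim, hzF _ (by rw [hNl]; simpa using hv) (by rw [hNr]; exact ⟨i₀, Finset.mem_univ _⟩),
      Finset.mem_singleton]
    constructor
    · intro h
      have := congrArg Finset.toLeft h
      rw [hNl, hNl] at this
      simpa using this
    · rintro rfl; rfl
  have hnew : ∀ e ∈ H.edges, e ⊆ E ∪ R → ¬ e ⊆ E → e = insert a R := by
    intro e he heE heE'
    let e' : Finset (V ⊕ Fin (s - 1)) :=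
      (e ∩ E).disjSum (Finset.univ.filter (fun i => z i ∈ e))
    have h1 : e'.image (Sum.elim id z) = e := by
      ext v
      simp only [Finset.mem_image]
      constructor
      · rintro ⟨(u | i), hu, rfl⟩
        · exact (Finset.mem_inter.1 (Finset.inl_mem_disjSum.1 hu)).1
        · exact (Finset.mem_filter.1 (Finset.inr_mem_disjSum.1 hu)).2
      · intro hv
        by_cases hvE : v ∈ E
        · exact ⟨Sum.inl v, by simp [e', hv, hvE], rfl⟩
        · have := heE hv
          rw [Finset.mem_union, Finset.mem_map] at this
          obtain ⟨i, -, rfl⟩ := this.resolve_left hvE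
          exact ⟨Sum.inr i, by simp [e', hv], rfl⟩
    have h2 : e'.toRight.Nonempty := by
      obtain ⟨v, hv, hvE⟩ := Finset.not_subset.1 heE'
      have := heE hv
      rw [Finset.mem_union, Finset.mem_map] at this
      obtain ⟨i, -, rfl⟩ := this.resolve_left hvE
      exact ⟨i, by simp [e', hv]⟩
    have h3 := (hzF e' (by simp [e']) h2).1 (by rwa [h1])
    rw [← h1, Finset.mem_singleton.1 h3, hNim]
  have haR : insert a R ∈ H.edges := (hNmem a haE).2 rfl
  -- Among the vertices of `E`, which contains `g • a`, only `a` completes `R` to a hyperedge. If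
  -- `g` fixed `R` pointwise, then it would fix `a`.
  obtain ⟨r, hrR, hgr⟩ : ∃ r ∈ R, g • r ≠ r := by
    by_contra! hfix
    have h1 : g • R = R := by
      conv_rhs => rw [← Finset.image_id (s := R)]
      exact Finset.image_congr hfix
    have h2 := (smul_mem_edges_iff g _).2 haR
    rw [Finset.smul_finset_insert, h1] at h2
    exact ha ((hNmem _ hgaE).1 h2)
  have hER : Disjoint E R := by
    rw [Finset.disjoint_right]
    intro v hv
    obtain ⟨i, -, rfl⟩ := Finset.mem_map.1 hv
    exact hzE i
  refine ⟨r, hgr, fun C hDC hrC => ?_⟩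
  refine le_trans ?_ (hzS.predim_inter_le hη₀ C)
  set X := C ∩ (E ∪ R) with hX
  have hXu : X = X ∩ E ∪ X ∩ R := by
    rw [← Finset.inter_union_distrib_left, Finset.inter_eq_left.2 Finset.inter_subset_right]
  have hrX : r ∈ X ∩ R := by simp [hX, hrC, hrR]
  have hDX : D ⊆ X ∩ E := by
    intro v hv
    simp [hX, hDC hv, hDE hv]
  have hcard : (X.card : ℝ) = (X ∩ E).card + (X ∩ R).card := by
    conv_lhs => rw [hXu]
    rw [Finset.card_union_of_disjoint (hER.mono Finset.inter_subset_right
      Finset.inter_subset_right)]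
    push_cast
    rfl
  have hXE : H.edgesIn X ⊆ H.edgesIn (X ∩ E) ∪ if insert a R ⊆ X then {insert a R} else ∅ := by
    intro e he
    obtain ⟨heX, he⟩ := mem_edgesIn.1 he
    rw [Finset.mem_union]
    by_cases heE : e ⊆ E
    · exact Or.inl (mem_edgesIn.2 ⟨Finset.subset_inter heX heE, he⟩)
    · right
      have := hnew e he (heX.trans Finset.inter_subset_right) heE
      rw [if_pos (by rwa [← this])]
      exact Finset.mem_singleton.2 this
  have hle := (Finset.card_le_card hXE).trans (Finset.card_union_le _ _)
  have hDE' := strong_iff.1 hD _ hDX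
  -- Either `X` contains the new hyperedge, hence `a` and all `s - 1` new vertices, or it has no new
  -- hyperedge and `r` alone adds `1`.
  by_cases haX : insert a R ⊆ X
  · rw [if_pos haX, Finset.card_singleton] at hle
    have hRX : X ∩ R = R := Finset.inter_eq_right.2 ((Finset.subset_insert _ _).trans haX)
    have hRc : ((X ∩ R).card : ℝ) = s - 1 := by
      rw [hRX, hR, Finset.card_map, Finset.card_univ, Fintype.card_fin, hs1]
    have haXE : a ∈ X ∩ E := Finset.mem_inter.2 ⟨haX (Finset.mem_insert_self _ _), haE⟩
    have h1 := ht _ hDX haXE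
    have h2 : η * ((H.edgesIn X).card : ℝ) ≤ η * ((H.edgesIn (X ∩ E)).card + 1) := by
      gcongr
      exact_mod_cast hle
    have h3 := min_le_right (1 : ℝ) (t + ((s : ℝ) - 1 - η))
    simp only [predim] at h1 ⊢
    linarith
  · rw [if_neg haX, Finset.card_empty, add_zero] at hle
    have h1 : (1 : ℝ) ≤ (X ∩ R).card := by
      exact_mod_cast Finset.card_pos.2 ⟨r, hrX⟩
    have h2 : η * ((H.edgesIn X).card : ℝ) ≤ η * (H.edgesIn (X ∩ E)).card := by
      gcongr
    have h3 := min_le_left (1 : ℝ) (t + ((s : ℝ) - 1 - η))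
    simp only [predim] at hDE' ⊢
    linarith

/-- A nontrivial automorphism moves a vertex that is free over a given finite strong set. -/
lemma IsHrushovskiGeneric.exists_moved_free (hs : 2 ≤ s) (hη₀ : 0 ≤ η) (hη₁ : η ≤ 1)
    (hdeg : ¬ (s = 2 ∧ η = 1)) (hH : H.IsHrushovskiGeneric η) {g : H.Aut} (hg : g ≠ 1)
    {D : Finset V} (hD : H.Strong η D) :
    ∃ z, g • z ≠ z ∧ ∀ C, D ⊆ C → z ∈ C → H.predim η D + 1 ≤ H.predim η C := by
  have hτ : 0 < (s : ℝ) - 1 - η := by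
    rcases hs.eq_or_lt with h | h
    · have : η < 1 := lt_of_le_of_ne hη₁ fun h' => hdeg ⟨h.symm, h'⟩
      rw [← h]
      push_cast
      linarith
    · have : (3 : ℝ) ≤ s := by exact_mod_cast h
      linarith
  set τ := (s : ℝ) - 1 - η
  have key : ∀ n : ℕ, ∃ z, g • z ≠ z ∧ ∀ C, D ⊆ C → z ∈ C →
      H.predim η D + min 1 (n * τ) ≤ H.predim η C := by
    intro n
    induction n with
    | zero =>
      obtain ⟨a, ha⟩ : ∃ a, g • a ≠ a := by
        by_contra! h
        exact hg (Subtype.ext (Equiv.ext h))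
      refine ⟨a, ha, fun C hC _ => ?_⟩
      have := strong_iff.1 hD C hC
      simpa using this
    | succ n ih =>
      obtain ⟨a, ha, hb⟩ := ih
      obtain ⟨r, hr, hr'⟩ := hH.exists_moved_of_moved hs hη₀ hη₁ g ha hb hD
      refine ⟨r, hr, fun C hC hrC => le_trans ?_ (hr' C hC hrC)⟩
      rw [add_le_add_iff_left]
      refine le_min (min_le_left _ _) ?_
      push_cast
      rcases le_total 1 (n * τ) with h | h
      · rw [min_eq_left h]
        exact (min_le_left _ _).trans (by linarith)
      · rw [min_eq_right h]
        exact (min_le_right _ _).trans (by linarith)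
  obtain ⟨n, hn⟩ := exists_nat_ge (1 / τ)
  obtain ⟨z, hz, hz'⟩ := key n
  refine ⟨z, hz, ?_⟩
  rwa [min_eq_left] at hz'
  rwa [div_le_iff₀ hτ] at hn

/-- One moved free vertex `z` is enough to get `g • R ≠ R`: the others are chosen free over a strong
set containing `g • z`, so that none of them equals it. -/
lemma IsHrushovskiGeneric.exists_free_block (hs : 2 ≤ s) (hη₀ : 0 ≤ η) (hη₁ : η ≤ 1)
    (hdeg : ¬ (s = 2 ∧ η = 1)) (hH : H.IsHrushovskiGeneric η) {g : H.Aut} (hg : g ≠ 1)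
    {D : Finset V} (hD : H.Strong η D) (n : ℕ) :
    ∃ R : Finset V, R.card = n + 1 ∧ (∃ z ∈ R, g • z ∉ R) ∧
      ∀ C, D ⊆ C → H.predim η D + (C ∩ R).card ≤ H.predim η C := by
  induction n with
  | zero =>
    obtain ⟨z, hz, hz'⟩ := hH.exists_moved_free hs hη₀ hη₁ hdeg hg hD
    refine ⟨{z}, by simp, ⟨z, by simpa using hz⟩, fun C hC => ?_⟩
    by_cases hzC : z ∈ C
    · rw [Finset.inter_singleton_of_mem hzC]
      simpa using hz' C hC hzC
    · rw [Finset.inter_singleton_of_notMem hzC]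
      simpa using strong_iff.1 hD C hC
  | succ n ih =>
    obtain ⟨R, hRc, ⟨z, hzR, hgz⟩, hR⟩ := ih
    obtain ⟨D', hDD', hD'⟩ := hH.exists_strong (insert (g • z) (D ∪ R))
    rw [Finset.insert_subset_iff, Finset.union_subset_iff] at hDD'
    obtain ⟨hgzD, hDD', hRD⟩ := hDD'
    obtain ⟨w, -, hw⟩ := hH.exists_moved_free hs hη₀ hη₁ hdeg hg hD'
    have hwD : w ∉ D' := by
      intro h
      have := hw D' subset_rfl h
      linarith
    have hwR : w ∉ R := fun h => hwD (hRD h)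
    refine ⟨insert w R, by rw [Finset.card_insert_of_notMem hwR, hRc],
      ⟨z, Finset.mem_insert_of_mem hzR, ?_⟩, fun C hC => ?_⟩
    · rw [Finset.mem_insert, not_or]
      exact ⟨fun h => hwD (h ▸ hgzD), hgz⟩
    · have h1 := predim_submodular hη₀ H C D'
      have h2 := hR (C ∩ D') (Finset.subset_inter hC hDD')
      rw [Finset.inter_assoc, Finset.inter_eq_right.2 hRD] at h2
      by_cases hwC : w ∈ C
      · have h3 := hw (C ∪ D') Finset.subset_union_right (Finset.mem_union_left _ hwC)
        rw [Finset.inter_insert_of_mem hwC,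
          Finset.card_insert_of_notMem fun h => hwR (Finset.mem_inter.1 h).2]
        push_cast
        linarith
      · have h3 := strong_iff.1 hD' (C ∪ D') Finset.subset_union_right
        rw [Finset.inter_insert_of_notMem hwC]
        linarith

/-- Over every strong set there are blocks `R` of `s - 1` vertices such that `R` and `g • R` have
relative dimension at least `η` and are independent up to the defect `c`. -/
def HasIndependentBlocks (η : ℝ) (H : UniformHypergraph s V) (g : H.Aut) (c : ℝ) : Prop :=
  ∀ D, H.Strong η D → ∃ R : Finset V, R.card + 1 = s ∧ g • R ≠ R ∧
    (∀ C, D ⊆ C → R ⊆ C → H.predim η D + η ≤ H.predim η C) ∧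
    (∀ C, D ⊆ C → g • R ⊆ C → H.predim η D + η ≤ H.predim η C) ∧
    ∀ C, D ⊆ C → R ⊆ C → g • R ⊆ C → H.predim η D + (2 * η - c) ≤ H.predim η C

/-- Bounds on the dimension of `g • R` over `D` from bounds on that of `R` over a larger set. -/
lemma Strong.le_of_smul_subset (hη : 0 ≤ η) {g : H.Aut} {D D' R C : Finset V} {t : ℝ}
    (hD : H.Strong η D) (hDD' : g⁻¹ • D ⊆ D')
    (hR : ∀ C, D' ⊆ C → R ⊆ C → H.predim η D' + t ≤ H.predim η C) (hC : D ⊆ C)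
    (hRC : g • R ⊆ C) : H.predim η D + t ≤ H.predim η C := by
  have h1 := (hD.smul g⁻¹).le_of_le_union (X := g⁻¹ • C) hη hDD'
    (Finset.smul_finset_subset_smul_finset hC) (hR (g⁻¹ • C ∪ D') Finset.subset_union_right
      ((Finset.smul_finset_subset_iff.1 hRC).trans Finset.subset_union_left))
  rwa [predim_smul, predim_smul] at h1

/-- A free block has relative dimension `s - 1` by itself, so the joint bound holds without looking
at `g • R`. -/
lemma IsHrushovskiGeneric.hasIndependentBlocks_of_free (hs : 2 ≤ s) (hη₀ : 0 ≤ η) (hη₁ : η ≤ 1)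
    (hdeg : ¬ (s = 2 ∧ η = 1)) (hH : H.IsHrushovskiGeneric η) {g : H.Aut} (hg : g ≠ 1)
    {c : ℝ} (hc : 2 * η - (s - 1) ≤ c) : HasIndependentBlocks η H g c := by
  intro D hD
  obtain ⟨D', hDD', hD'⟩ := hH.exists_strong (D ∪ g⁻¹ • D)
  rw [Finset.union_subset_iff] at hDD'
  obtain ⟨R, hRc, ⟨z, hz, hgz⟩, hR⟩ := hH.exists_free_block hs hη₀ hη₁ hdeg hg hD' (s - 2)
  have hsc : (R.card : ℝ) = s - 1 := by
    rw [hRc]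
    have : ((s - 2 + 1 : ℕ) : ℝ) = (s - 1 : ℕ) := by congr 1; omega
    rw [this, Nat.cast_sub (by omega)]
    simp
  have hs2 : (2 : ℝ) ≤ s := by exact_mod_cast hs
  have hR' : ∀ C, D' ⊆ C → R ⊆ C → H.predim η D' + (s - 1) ≤ H.predim η C := by
    intro C hC hRC
    have := hR C hC
    rwa [Finset.inter_eq_right.2 hRC, hsc] at this
  have hR1 : ∀ C, D ⊆ C → R ⊆ C → H.predim η D + (s - 1) ≤ H.predim η C :=
    fun C hC hRC => hD.le_of_le_union hη₀ hDD'.1 hC (hR' _ Finset.subset_union_right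
      (hRC.trans Finset.subset_union_left))
  refine ⟨R, by omega, ?_, ?_, ?_, ?_⟩
  · intro h
    exact hgz (h ▸ Finset.smul_mem_smul_finset hz)
  · intro C hC hRC
    have := hR1 C hC hRC
    linarith
  · intro C hC hRC
    have := hD.le_of_smul_subset hη₀ hDD'.2 hR' hC hRC
    linarith
  · intro C hC hRC _
    have := hR1 C hC hRC
    linarith

/-- Finite independent families of blocks. -/
lemma HasIndependentBlocks.exists_family (hη : 0 < η) (hH : H.IsHrushovskiGeneric η) {g : H.Aut}
    {c : ℝ} (hc : 0 ≤ c) (h : HasIndependentBlocks η H g c) {D : Finset V} (hD : H.Strong η D)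
    (k : ℕ) :
    ∃ L : Finset (Finset V), L.card = k ∧ (∀ ℓ ∈ L, ℓ.card + 1 = s) ∧
      (∀ ℓ ∈ L, ∀ ℓ' ∈ L, g • ℓ ≠ ℓ') ∧
      (∀ C, D ⊆ C → H.predim η D + η * ((L.filter (· ⊆ C)).card : ℝ) ≤ H.predim η C) ∧
      (∀ C, D ⊆ C → H.predim η D + η * ((L.filter (g • · ⊆ C)).card : ℝ) ≤ H.predim η C) ∧
      ∀ C, D ⊆ C → H.predim η D + η * (((L.filter (· ⊆ C)).card : ℝ) +
        (L.filter (g • · ⊆ C)).card) - c * k ≤ H.predim η C := by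
  induction k with
  | zero =>
    refine ⟨∅, by simp, by simp, by simp, ?_, ?_, ?_⟩ <;>
    · intro C hC
      simpa using strong_iff.1 hD C hC
  | succ k ih =>
    obtain ⟨L, hLk, hLs, hLg, hL0, hL1, hL2⟩ := ih
    -- The next block is taken over a strong set containing all earlier blocks and their translates.
    -- By submodularity the bounds add up, and each new block adds at most `c` to the total defect.
    obtain ⟨D', hDD', hD'⟩ := hH.exists_strong
      (D ∪ (L.biUnion id ∪ g • L.biUnion id))
    simp only [Finset.union_subset_iff] at hDD'
    obtain ⟨hDD', hLD, hgLD⟩ := hDD'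
    have hLD1 : ∀ ℓ ∈ L, ℓ ⊆ D' := fun ℓ hℓ =>
      (Finset.subset_biUnion_of_mem id hℓ).trans hLD
    have hLD2 : ∀ ℓ ∈ L, g • ℓ ⊆ D' := fun ℓ hℓ =>
      (Finset.smul_finset_subset_smul_finset (Finset.subset_biUnion_of_mem id hℓ)).trans hgLD
    obtain ⟨R, hRs, hRg, hR1, hR2, hR3⟩ := h D' hD'
    have hRD : ¬ R ⊆ D' := fun h => by
      have := hR1 D' subset_rfl h
      linarith
    have hgRD : ¬ g • R ⊆ D' := fun h => by
      have := hR2 D' subset_rfl h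
      linarith
    have hRL : R ∉ L := fun h => hRD (hLD1 R h)
    have hf1 : ∀ C, L.filter (· ⊆ C ∩ D') = L.filter (· ⊆ C) := fun C =>
      Finset.filter_congr fun ℓ hℓ => by
        simp [Finset.subset_inter_iff, hLD1 ℓ hℓ]
    have hf2 : ∀ C, L.filter (g • · ⊆ C ∩ D') = L.filter (g • · ⊆ C) := fun C =>
      Finset.filter_congr fun ℓ hℓ => by
        simp [Finset.subset_inter_iff, hLD2 ℓ hℓ]
    have hi1 : ∀ C, (((insert R L).filter (· ⊆ C)).card : ℝ) =
        (L.filter (· ⊆ C)).card + if R ⊆ C then 1 else 0 := by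
      intro C
      rw [Finset.filter_insert]
      split_ifs
      · rw [Finset.card_insert_of_notMem (by simp [hRL])]
        push_cast
        rfl
      · simp
    have hi2 : ∀ C, (((insert R L).filter (g • · ⊆ C)).card : ℝ) =
        (L.filter (g • · ⊆ C)).card + if g • R ⊆ C then 1 else 0 := by
      intro C
      rw [Finset.filter_insert]
      split_ifs
      · rw [Finset.card_insert_of_notMem (by simp [hRL])]
        push_cast
        rfl
      · simp
    refine ⟨insert R L, by rw [Finset.card_insert_of_notMem hRL, hLk], ?_, ?_, ?_, ?_, ?_⟩
    · intro ℓ hℓ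
      rcases Finset.mem_insert.1 hℓ with rfl | hℓ
      · exact hRs
      · exact hLs ℓ hℓ
    · intro ℓ hℓ ℓ' hℓ'
      rcases Finset.mem_insert.1 hℓ with rfl | hm <;> rcases Finset.mem_insert.1 hℓ' with rfl | hm'
      · exact hRg
      · exact fun h => hgRD (h ▸ hLD1 _ hm')
      · exact fun h => hRD (h ▸ hLD2 _ hm)
      · exact hLg ℓ hm ℓ' hm'
    · intro C hC
      have h1 := predim_submodular hη.le H C D'
      have h2 := hL0 (C ∩ D') (Finset.subset_inter hC hDD')
      have h3 := strong_iff.1 hD' (C ∪ D') Finset.subset_union_right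
      rw [hf1] at h2
      rw [hi1]
      split_ifs with hRC
      · have h4 := hR1 (C ∪ D') Finset.subset_union_right (hRC.trans Finset.subset_union_left)
        linarith
      · linarith
    · intro C hC
      have h1 := predim_submodular hη.le H C D'
      have h2 := hL1 (C ∩ D') (Finset.subset_inter hC hDD')
      have h3 := strong_iff.1 hD' (C ∪ D') Finset.subset_union_right
      rw [hf2] at h2
      rw [hi2]
      split_ifs with hRC
      · have h4 := hR2 (C ∪ D') Finset.subset_union_right (hRC.trans Finset.subset_union_left)
        linarith
      · linarith
    · intro C hC
      have h1 := predim_submodular hη.le H C D'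
      have h2 := hL2 (C ∩ D') (Finset.subset_inter hC hDD')
      have h3 := strong_iff.1 hD' (C ∪ D') Finset.subset_union_right
      have h4 := fun hRC : R ⊆ C =>
        hR1 (C ∪ D') Finset.subset_union_right (hRC.trans Finset.subset_union_left)
      have h5 := fun hRC : g • R ⊆ C =>
        hR2 (C ∪ D') Finset.subset_union_right (hRC.trans Finset.subset_union_left)
      have h6 := fun (hRC : R ⊆ C) (hRC' : g • R ⊆ C) =>
        hR3 (C ∪ D') Finset.subset_union_right (hRC.trans Finset.subset_union_left)
          (hRC'.trans Finset.subset_union_left)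
      rw [hf1, hf2] at h2
      rw [hi1, hi2]
      push_cast
      split_ifs with hRC hRC' hRC'
      · have := h6 hRC hRC'
        linarith
      · have := h4 hRC
        linarith
      · have := h5 hRC'
        linarith
      · linarith

end Blocks

end UniformHypergraph

namespace UniformHypergraph

/-! ### Copies whose generator is independent from its image under `g`. -/

section GenericCopy

open Classical
open scoped Pointwise

variable {s : ℕ} {V : Type*} {η : ℝ} {H : UniformHypergraph s V}

lemma mul_card_filter_le_of_imp {α : Type*} (hη : 0 ≤ η) (L : Finset α) {p q : α → Prop}
    [DecidablePred p] [DecidablePred q] (h : ∀ ℓ ∈ L, p ℓ → q ℓ) :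
    η * ((L.filter p).card : ℝ) ≤ η * ((L.filter q).card : ℝ) := by
  have := Finset.card_le_card (Finset.monotone_filter_right L h)
  gcongr

/-- A strong extension `A ⊆ B` generated by `q`, all of whose proper intermediate extensions have
dimension close to that of `B`, can be copied over `A` such that the
image of the copy of `q` under `g` has large relative dimension over `D` and the copy of `q`. -/
lemma IsHrushovskiGeneric.exists_generic_copy (hs : s ≠ 0) (hη : 0 < η)
    (hH : H.IsHrushovskiGeneric η) {g : H.Aut} {c : ℝ} (hc : 0 ≤ c)
    (hg : HasIndependentBlocks η H g c) {A B D : Finset V} {q : V} (hAB : A ⊆ B)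
    (hA : H.Strong η A) (hB : H.Strong η B) (hD : H.Strong η D) (hAD : A ⊆ D) (hqB : q ∈ B)
    (hqA : q ∉ A) (hgen : ∀ X, A ⊆ X → q ∈ X → H.predim η B ≤ H.predim η X)
    (hprim : ∀ X, A ⊂ X → X ⊆ B → H.predim η B - η < H.predim η X)
    (hdim : H.predim η A + η ≤ H.predim η B) :
    ∃ y : H.Aut, (∀ a ∈ A, y • a = a) ∧ g • y • q ≠ y • q ∧
      (∀ C, D ⊆ C → y • q ∈ C → H.predim η D + (H.predim η B - H.predim η A) ≤ H.predim η C) ∧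
      ∃ k : ℕ, 1 ≤ k ∧ ∀ C, D ⊆ C → y • q ∈ C → g • y • q ∈ C →
        H.predim η D + (H.predim η B - H.predim η A) + k * (η - c) ≤ H.predim η C := by
  set α := H.predim η B - H.predim η A with hα
  set k := ⌊α / η⌋₊ with hk
  -- `k` is the largest number of links that the relative dimension `α` can pay for, so the
  -- remainder `α - η * k` lies in `[0, η)`.
  have hηα : η ≤ α := by linarith
  have hk1 : 1 ≤ k := Nat.le_floor (by rw [Nat.cast_one, le_div_iff₀ hη]; linarith)
  have hkα : η * k ≤ α := by
    have := Nat.floor_le (div_nonneg (hη.le.trans hηα) hη.le)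
    rw [le_div_iff₀ hη] at this
    linarith
  have hαk : α < η * k + η := by
    have := Nat.lt_floor_add_one (α / η)
    rw [div_lt_iff₀ hη] at this
    linarith
  obtain ⟨L, hLk, hLs, hLg, hL0, hL1, hL2⟩ := hg.exists_family hη hH hc hD k
  set U := L.biUnion id with hU
  have hLU : ∀ ℓ ∈ L, ℓ ⊆ U := fun ℓ hℓ => Finset.subset_biUnion_of_mem id hℓ
  obtain ⟨E, hE', hE⟩ := hH.exists_strong (D ∪ (U ∪ g • (A ∪ U)))
  simp only [Finset.union_subset_iff] at hE'
  obtain ⟨hDE, hUE, hgE⟩ := hE'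
  -- Placing the copy outside `g⁻¹ • E` as well ensures that the image of its generator under `g` is
  -- not in `E`.
  obtain ⟨E₂, hE₂', hE₂⟩ := hH.exists_strong (E ∪ g⁻¹ • E)
  rw [Finset.union_subset_iff] at hE₂'
  obtain ⟨hEE, hgEE⟩ := hE₂'
  have hAE : A ⊆ E := hAD.trans hDE
  obtain ⟨y, cp⟩ := hH.exists_isLinkedCopy hs hη hAB hB (hAE.trans hEE) hE₂ hqB hqA L
    (fun ℓ hℓ => ((hLU ℓ hℓ).trans hUE).trans hEE) hLs
    (by
      intro X hAX _
      split_ifs with hqX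
      · rw [hLk]
        have := hgen X hAX hqX
        linarith
      · simpa using strong_iff.1 hA X hAX)
    (by
      intro X hAX _
      refine hA.le_of_le_union hη.le hAD hAX (le_trans ?_ (hL0 (X ∪ D) Finset.subset_union_right))
      rw [add_le_add_iff_left]
      exact mul_card_filter_le_of_imp hη.le _ fun ℓ _ h => h.trans Finset.subset_union_left)
  have hAyB := cp.base_subset
  have hyq : y • q ∈ y • B := Finset.smul_mem_smul_finset hqB
  have hyqE : y • q ∉ E₂ := cp.smul_notMem q hqB hqA
  have hgen' : ∀ X, A ⊆ X → y • q ∈ X → H.predim η B ≤ H.predim η X := by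
    intro X hAX hqX
    rw [← predim_smul y⁻¹ X]
    refine hgen _ ?_ (Finset.mem_inv_smul_finset_iff.2 hqX)
    rwa [← Finset.smul_finset_subset_iff, cp.smul_base]
  have hinter : E ∩ y • B = A := by
    refine Finset.Subset.antisymm ?_ (Finset.subset_inter hAE hAyB)
    rw [← cp.inter_eq]
    exact Finset.inter_subset_inter_right hEE
  set X₀ := E ∪ y • B with hX₀
  have hX₀E₂ : X₀ ⊆ E₂ ∪ y • B := Finset.union_subset_union_left hEE
  have hX₀i : X₀ ∩ E₂ = E := by
    rw [hX₀, Finset.union_inter_distrib_right, Finset.inter_eq_left.2 hEE, Finset.inter_comm,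
      cp.inter_eq, Finset.union_eq_left.2 hAE]
  have hX₀B : X₀ ∩ y • B = y • B := Finset.inter_eq_right.2 Finset.subset_union_right
  have hfull : ∀ X, U ⊆ X → L.filter (· ⊆ X) = L := fun X hX =>
    Finset.filter_true_of_mem fun ℓ hℓ => (hLU ℓ hℓ).trans hX
  have hX₀δ : H.predim η X₀ = H.predim η E + α - η * k := by
    rw [cp.predim_eq hX₀E₂, hX₀i, hX₀B, predim_smul,
      Finset.inter_eq_right.2 (hAE.trans Finset.subset_union_left),
      if_pos (Finset.mem_union_right _ hyq), hfull _ (hUE.trans Finset.subset_union_left), hLk]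
    ring
  have hX₀s : ∀ X, X₀ ⊆ X → H.predim η X₀ ≤ H.predim η X := by
    intro X hX
    refine le_trans ?_ (cp.strong.predim_inter_le hη.le X)
    have hX' : X₀ ⊆ X ∩ (E₂ ∪ y • B) := Finset.subset_inter hX hX₀E₂
    have h1 : y • B ⊆ X ∩ (E₂ ∪ y • B) := Finset.subset_union_right.trans hX'
    have h2 : E ⊆ X ∩ (E₂ ∪ y • B) := Finset.subset_union_left.trans hX'
    rw [cp.predim_eq Finset.inter_subset_right, if_pos (h1 hyq), hfull _ (hUE.trans h2), hLk,
      Finset.inter_eq_right.2 h1, Finset.inter_eq_right.2 (hAE.trans h2), predim_smul, hX₀δ]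
    have := strong_iff.1 hE _ (Finset.subset_inter h2 hEE)
    linarith
  set P := U ∪ y • B with hP
  have hPE₂ : P ⊆ E₂ ∪ y • B := Finset.union_subset_union_left (hUE.trans hEE)
  set AU := A ∪ U with hAU
  have hPi : P ∩ E₂ = AU := by
    rw [hP, Finset.union_inter_distrib_right, Finset.inter_eq_left.2 (hUE.trans hEE),
      Finset.inter_comm, cp.inter_eq, Finset.union_comm]
  have hAP : A ⊆ P := hAyB.trans Finset.subset_union_right
  have hAUP : AU ⊆ P := Finset.union_subset hAP Finset.subset_union_left
  have hyqP : y • q ∈ P := Finset.mem_union_right _ hyq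
  have hPδ : H.predim η P = H.predim η AU + α - η * k := by
    rw [cp.predim_eq hPE₂, hPi, Finset.inter_eq_right.2 Finset.subset_union_right, predim_smul,
      Finset.inter_eq_right.2 hAP, if_pos hyqP, hfull _ Finset.subset_union_left, hLk]
    ring
  have hgyqE : g • y • q ∉ E := fun h =>
    hyqE (hgEE (Finset.mem_inv_smul_finset_iff.2 h))
  have hAUE₂ : AU ⊆ E₂ := hPi ▸ Finset.inter_subset_right
  -- A larger overlap is impossible. If it omits `y • q`, then by `hprim` it uses up more than `α -
  -- η` of the dimension, and gluing `g • P` to `X₀` would go below the predimension of the strong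
  -- set `X₀`.
  have hQ : P ∩ g⁻¹ • X₀ = AU := by
    set Q := P ∩ g⁻¹ • X₀ with hQdef
    have hAUQ : AU ⊆ Q := Finset.subset_inter hAUP
      (Finset.smul_finset_subset_iff.1 (hgE.trans Finset.subset_union_left))
    by_contra hne
    have hQE₂ : Q ∩ E₂ = AU := by
      refine Finset.Subset.antisymm ?_ (Finset.subset_inter hAUQ hAUE₂)
      rw [← hPi]
      exact Finset.inter_subset_inter_right Finset.inter_subset_left
    have hyqQ : y • q ∉ Q := by
      intro h
      have h1 : g • y • q ∈ X₀ := Finset.mem_inv_smul_finset_iff.1 (Finset.mem_inter.1 h).2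
      have h2 : g • y • q ∈ y • B := (Finset.mem_union.1 h1).resolve_left hgyqE
      have h3 : g • y • q ∉ E₂ := fun h3 => hgyqE (hAE (cp.inter_eq ▸ Finset.mem_inter.2 ⟨h3, h2⟩))
      obtain ⟨ℓ, hℓ⟩ : L.Nonempty := Finset.card_pos.1 (by omega)
      have hgℓE : g • ℓ ⊆ E := (Finset.smul_finset_subset_smul_finset
        ((hLU ℓ hℓ).trans Finset.subset_union_right)).trans hgE
      have h4 := (smul_mem_edges_iff g _).2 (cp.link_mem ℓ hℓ)
      rw [Finset.smul_finset_insert] at h4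
      -- If the overlap contained `y • q`, the `g`-image of a link would be a hyperedge of the
      -- amalgam. It is not inside `E₂`; inside the copy it would force `g • ℓ ⊆ D`; and as a link
      -- it would give `g • ℓ = ℓ'`.
      rcases cp.edges _ h4 (Finset.insert_subset (hX₀E₂ h1)
        ((hgℓE.trans hEE).trans Finset.subset_union_left)) with h5 | h5 | ⟨ℓ', hℓ', h5⟩
      · exact h3 (h5 (Finset.mem_insert_self _ _))
      · have h6 : g • ℓ ⊆ D := by
          refine Finset.Subset.trans ?_ hAD
          rw [← hinter]
          exact Finset.subset_inter hgℓE ((Finset.subset_insert _ _).trans h5)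
        have h7 := hL1 D subset_rfl
        have h8 : 0 < (L.filter (g • · ⊆ D)).card := Finset.card_pos.2 ⟨ℓ, by simp [hℓ, h6]⟩
        have h9 : 0 < η * ((L.filter (g • · ⊆ D)).card : ℝ) := by positivity
        linarith
      · have h6 := congrArg (· ∩ E₂) h5
        simp only [Finset.insert_inter_of_notMem h3, Finset.insert_inter_of_notMem hyqE] at h6
        rw [Finset.inter_eq_left.2 (hgℓE.trans hEE),
          Finset.inter_eq_left.2 (cp.link_subset ℓ' hℓ')] at h6
        exact hLg ℓ hℓ ℓ' hℓ' h6
    have hAQ : A ⊆ Q := Finset.subset_union_left.trans hAUQ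
    have h1 : H.predim η B - η < H.predim η (Q ∩ y • B) := by
      rw [← predim_smul y⁻¹ (Q ∩ y • B)]
      refine hprim _ (Finset.ssubset_iff_subset_ne.2 ⟨?_, ?_⟩) ?_
      · rw [← Finset.smul_finset_subset_iff, cp.smul_base]
        exact Finset.subset_inter hAQ hAyB
      · intro h
        refine hne (Finset.Subset.antisymm (fun v hv => ?_) hAUQ)
        rcases Finset.mem_union.1 (Finset.mem_inter.1 hv).1 with hvU | hvB
        · exact Finset.mem_union_right _ hvU
        · refine Finset.mem_union_left _ ?_
          rw [← cp.smul_base, h, smul_inv_smul]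
          exact Finset.mem_inter.2 ⟨hv, hvB⟩
      · rw [← Finset.subset_smul_finset_iff]
        exact Finset.inter_subset_right
    have h2 := cp.predim_eq (Finset.inter_subset_left.trans hPE₂ : Q ⊆ _)
    rw [hQE₂, if_neg hyqQ, Finset.inter_eq_right.2 hAQ] at h2
    have h3 := predim_submodular hη.le H X₀ (g • P)
    have h4 : X₀ ∩ g • P = g • Q := by
      rw [hQdef, Finset.smul_finset_inter, smul_inv_smul, Finset.inter_comm]
    rw [h4, predim_smul, predim_smul] at h3
    have h5 := hX₀s _ (Finset.subset_union_left : X₀ ⊆ X₀ ∪ g • P)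
    have h6 : η * 1 ≤ η * (k : ℝ) := by
      gcongr
      exact_mod_cast hk1
    linarith
  have hXP : X₀ ∩ g • P = g • AU := by
    rw [← hQ, Finset.smul_finset_inter, smul_inv_smul, Finset.inter_comm]
  set Y := X₀ ∪ g • P with hY
  have hcross : H.crossEdges X₀ (g • P) = ∅ ∧ H.predim η Y = H.predim η X₀ + (α - η * k) := by
    have h1 := predim_union_add_inter η H X₀ (g • P)
    rw [hXP, predim_smul, predim_smul, hPδ] at h1
    have h2 := hX₀s Y Finset.subset_union_left
    -- A crossing hyperedge would cost `η`, more than the remainder `α - η * k`.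
    have h3 : (H.crossEdges X₀ (g • P)).card = 0 := by
      by_contra h
      have h4 : (1 : ℝ) ≤ (H.crossEdges X₀ (g • P)).card := by
        exact_mod_cast Nat.one_le_iff_ne_zero.2 h
      have h5 : η * 1 ≤ η * ((H.crossEdges X₀ (g • P)).card : ℝ) := by gcongr
      linarith
    refine ⟨Finset.card_eq_zero.1 h3, ?_⟩
    rw [h3] at h1
    push_cast at h1
    linarith
  obtain ⟨hcross, hYδ⟩ := hcross
  refine ⟨y, cp.smul_eq, ?_, ?_, k, hk1, ?_⟩
  · intro h
    refine hyqE (hAUE₂ ?_)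
    rw [← hQ]
    refine Finset.mem_inter.2 ⟨hyqP, Finset.mem_inv_smul_finset_iff.2 ?_⟩
    rw [h]
    exact Finset.mem_union_right _ hyq
  · intro C hC hqC
    refine le_trans ?_ (cp.strong.predim_inter_le hη.le C)
    set X := C ∩ (E₂ ∪ y • B) with hX
    have hDX : D ⊆ X := Finset.subset_inter hC ((hDE.trans hEE).trans Finset.subset_union_left)
    have hqX : y • q ∈ X := Finset.mem_inter.2 ⟨hqC, Finset.mem_union_right _ hyq⟩
    have hAX : A ⊆ X := hAD.trans hDX
    rw [cp.predim_eq Finset.inter_subset_right, if_pos hqX, Finset.inter_eq_right.2 hAX]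
    have h1 := hgen' (X ∩ y • B) (Finset.subset_inter hAX hAyB) (Finset.mem_inter.2 ⟨hqX, hyq⟩)
    have h2 := hL0 (X ∩ E₂) (Finset.subset_inter hDX (hDE.trans hEE))
    have h3 : η * ((L.filter (· ⊆ X)).card : ℝ) ≤ η * (L.filter (· ⊆ X ∩ E₂)).card :=
      mul_card_filter_le_of_imp hη.le _ fun ℓ hℓ h => Finset.subset_inter h (cp.link_subset ℓ hℓ)
    linarith
  · intro C hC hqC hgqC
    set W := C ∩ Y with hW
    have hDW : D ⊆ W := Finset.subset_inter hC
      ((hDE.trans Finset.subset_union_left).trans Finset.subset_union_left)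
    have hAW : A ⊆ W := hAD.trans hDW
    have hAX₀ : A ⊆ X₀ := hAE.trans Finset.subset_union_left
    have hqX₀ : y • q ∈ X₀ := Finset.mem_union_right _ hyq
    have hqW : y • q ∈ W := Finset.mem_inter.2 ⟨hqC, Finset.mem_union_left _ hqX₀⟩
    have hgqP : g • y • q ∈ g • P := Finset.smul_mem_smul_finset hyqP
    have hgqW : g • y • q ∈ W := Finset.mem_inter.2 ⟨hgqC, Finset.mem_union_right _ hgqP⟩
    -- reduction from `C` to `W`
    have h1 := predim_submodular hη.le H C Y
    have h2 := hX₀s (C ∪ Y) (Finset.subset_union_left.trans Finset.subset_union_right)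
    -- `W` is the free amalgam of its two parts
    have h3 := predim_union_add_inter η H (W ∩ X₀) (W ∩ g • P)
    have h4 : W ∩ X₀ ∪ W ∩ g • P = W := by
      rw [← Finset.inter_union_distrib_left, Finset.inter_eq_left.2 Finset.inter_subset_right]
    have h5 : H.crossEdges (W ∩ X₀) (W ∩ g • P) = ∅ := by
      rw [Finset.eq_empty_iff_forall_notMem]
      intro e he
      rw [mem_crossEdges, h4] at he
      obtain ⟨he1, he2, he3, he4⟩ := he
      have : e ∈ H.crossEdges X₀ (g • P) := mem_crossEdges.2
        ⟨he1.trans Finset.inter_subset_right, he2, fun h => he3 (Finset.subset_inter he1 h),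
          fun h => he4 (Finset.subset_inter he1 h)⟩
      rw [hcross] at this
      simp at this
    rw [h4, h5, ← Finset.inter_inter_distrib_left, hXP] at h3
    -- the part inside `X₀`
    have h6 := cp.predim_eq (Finset.inter_subset_right.trans hX₀E₂ : W ∩ X₀ ⊆ _)
    rw [Finset.inter_assoc W X₀ E₂, Finset.inter_assoc W X₀ (y • B), Finset.inter_assoc W X₀ A,
      hX₀i, hX₀B, Finset.inter_eq_right.2 hAX₀, Finset.inter_eq_right.2 hAW,
      if_pos (Finset.mem_inter.2 ⟨hqW, hqX₀⟩)] at h6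
    have h7 := hgen' (W ∩ y • B) (Finset.subset_inter hAW hAyB) (Finset.mem_inter.2 ⟨hqW, hyq⟩)
    have h8 : η * ((L.filter (· ⊆ W ∩ X₀)).card : ℝ) ≤ η * (L.filter (· ⊆ W ∩ E)).card :=
      mul_card_filter_le_of_imp hη.le _ fun ℓ hℓ h =>
        Finset.subset_inter (h.trans Finset.inter_subset_left)
        ((hLU ℓ hℓ).trans hUE)
    -- the part inside `g • P`
    set W' := g⁻¹ • W ∩ P with hW'
    have h9 : W ∩ g • P = g • W' := by
      rw [hW', Finset.smul_finset_inter, smul_inv_smul]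
    have hqW' : y • q ∈ W' :=
      Finset.mem_inter.2 ⟨Finset.mem_inv_smul_finset_iff.2 hgqW, hyqP⟩
    have h10 := cp.predim_eq (X := W') (Finset.inter_subset_right.trans hPE₂)
    have h11 : H.predim η (W' ∩ E₂) = H.predim η (W ∩ g • AU) := by
      rw [← predim_smul g (W' ∩ E₂), hW', Finset.inter_assoc, hPi, Finset.smul_finset_inter,
        smul_inv_smul]
    rw [h11, if_pos hqW'] at h10
    -- `W'` need not contain `A`, so `A` is added before the minimality of `B` is applied.
    have h12 := predim_submodular hη.le H (W' ∩ y • B) A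
    have h13 := hgen' (W' ∩ y • B ∪ A) Finset.subset_union_right
      (Finset.mem_union_left _ (Finset.mem_inter.2 ⟨hqW', hyq⟩))
    rw [Finset.inter_assoc W' (y • B) A, Finset.inter_eq_right.2 hAyB] at h12
    have h14 : η * ((L.filter (· ⊆ W')).card : ℝ) ≤ η * (L.filter (g • · ⊆ W ∩ E)).card := by
      refine mul_card_filter_le_of_imp hη.le _ fun ℓ hℓ h => ?_
      refine Finset.subset_inter ?_ ((Finset.smul_finset_subset_smul_finset
        ((hLU ℓ hℓ).trans Finset.subset_union_right)).trans hgE)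
      exact Finset.smul_finset_subset_iff.2 (h.trans Finset.inter_subset_left)
    -- Both generators contribute `α`. The links they use are repaid by the blocks in `W ∩ E`, up to
    -- the defect `c * k`, and `α ≥ η * k` then gives the claim.
    have h15 := hL2 (W ∩ E) (Finset.subset_inter hDW hDE)
    rw [h9, predim_smul] at h3
    simp only [Finset.card_empty, Nat.cast_zero, mul_zero, add_zero] at h3
    linarith

end GenericCopy

end UniformHypergraph

namespace UniformHypergraph

/-! ### Removing the defect, and the one-letter step. -/

section Step

open Classical
open scoped Pointwise

variable {s : ℕ} {V : Type*} {η : ℝ} {H : UniformHypergraph s V}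

/-- A strong extension generated by `q` has a copy whose generator keeps its relative dimension over
a given strong set. -/
lemma IsHrushovskiGeneric.exists_free_copy (hs : s ≠ 0) (hη : 0 < η)
    (hH : H.IsHrushovskiGeneric η) {A B D : Finset V} {q : V} (hAB : A ⊆ B)
    (hA : H.Strong η A) (hB : H.Strong η B) (hD : H.Strong η D) (hAD : A ⊆ D) (hqB : q ∈ B)
    (hqA : q ∉ A) (hgen : ∀ X, A ⊆ X → q ∈ X → H.predim η B ≤ H.predim η X) :
    ∃ y : H.Aut, (∀ a ∈ A, y • a = a) ∧ y • q ∉ D ∧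
      ∀ C, D ⊆ C → y • q ∈ C → H.predim η D + (H.predim η B - H.predim η A) ≤ H.predim η C := by
  obtain ⟨y, cp⟩ := hH.exists_isLinkedCopy hs hη hAB hB hAD hD hqB hqA ∅ (by simp) (by simp)
    (fun X hAX _ => by simpa using strong_iff.1 hA X hAX)
    (fun X hAX _ => by simpa using strong_iff.1 hA X hAX)
  refine ⟨y, cp.smul_eq, cp.smul_notMem q hqB hqA, fun C hC hqC => ?_⟩
  refine le_trans ?_ (cp.strong.predim_inter_le hη.le C)
  have hDX : D ⊆ C ∩ (D ∪ y • B) := Finset.subset_inter hC Finset.subset_union_left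
  have hAX := hAD.trans hDX
  have hyq : y • q ∈ y • B := Finset.smul_mem_smul_finset hqB
  rw [cp.predim_eq Finset.inter_subset_right, Finset.inter_eq_right.2 hAX,
    Finset.inter_eq_right.2 hDX]
  have h1 := hgen (y⁻¹ • (C ∩ (D ∪ y • B) ∩ y • B))
    (by
      rw [← Finset.smul_finset_subset_iff, cp.smul_base]
      exact Finset.subset_inter hAX cp.base_subset)
    (by
      rw [Finset.mem_inv_smul_finset_iff]
      simp [hqC, hyq])
  rw [predim_smul] at h1
  simp only [Finset.filter_empty, Finset.card_empty, Nat.cast_zero, ite_self, mul_zero, sub_zero]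
  linarith

lemma IsHrushovskiGeneric.exists_free_vertex (hs : 2 ≤ s) (hH : H.IsHrushovskiGeneric η)
    (hη : 0 ≤ η) : ∃ q : V, ∀ X, q ∈ X → 1 ≤ H.predim η X := by
  obtain ⟨z, -, hz, -⟩ := hH.exists_extension (ι := Unit) (by omega)
    (hH.strong_empty (by omega)) ∅ (by simp) (by simp) (by simp) hη
  refine ⟨z (), fun X hX => ?_⟩
  have h1 : (∅ ∪ Finset.univ.map z : Finset V) = {z ()} := by simp
  rw [h1] at hz
  have h2 := strong_iff.1 hz X (by simpa using hX)
  rwa [predim_singleton hs] at h2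

/-- For graphs a block is one vertex. Copying a free vertex has `α = 1`, so with `k ≥ 1` and `c ≤ η`
the pair has relative dimension at least `1 + (η - c) = 2 * η - (c - (1 - η))`. -/
lemma IsHrushovskiGeneric.hasIndependentBlocks_improve (hs : s = 2) (hη : 0 < η)
    (hH : H.IsHrushovskiGeneric η) (hη₁ : η ≤ 1)
    {g : H.Aut} {c c' : ℝ} (hc : 0 ≤ c) (hcη : c ≤ η) (hc' : c - (1 - η) ≤ c')
    (hg : HasIndependentBlocks η H g c) : HasIndependentBlocks η H g c' := by
  intro D hD
  obtain ⟨D', hDD', hD'⟩ := hH.exists_strong (D ∪ g⁻¹ • D)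
  rw [Finset.union_subset_iff] at hDD'
  obtain ⟨q, hq⟩ := hH.exists_free_vertex hs.ge hη.le
  have hq1 : H.predim η {q} = 1 := predim_singleton hs.ge q
  have h0 : H.predim η ∅ = 0 := predim_empty (by omega)
  obtain ⟨y, -, hgy, hy1, k, hk, hy2⟩ := hH.exists_generic_copy (by omega) hη hc hg
    (Finset.empty_subset {q}) (hH.strong_empty (by omega))
    (strong_iff.2 fun X hX => by rw [hq1]; exact hq X (by simpa using hX)) hD'
    (Finset.empty_subset _) (Finset.mem_singleton_self q) (Finset.notMem_empty q)
    (fun X _ hX => by rw [hq1]; exact hq X hX)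
    (fun X hX hXq => by
      have : X = {q} := (Finset.subset_singleton_iff.1 hXq).resolve_left
        (Finset.nonempty_iff_ne_empty.1 (Finset.empty_ssubset.1 hX))
      rw [this]
      linarith) (by rw [hq1, h0]; linarith)
  rw [hq1, h0] at hy1 hy2
  have hy1' : ∀ C, D' ⊆ C → {y • q} ⊆ C → H.predim η D' + η ≤ H.predim η C := by
    intro C hC hqC
    have := hy1 C hC (by simpa using hqC)
    linarith
  refine ⟨{y • q}, by simp [hs], ?_, ?_, ?_, ?_⟩
  · rw [Finset.smul_finset_singleton]
    simpa using hgy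
  · intro C hC hqC
    exact hD.le_of_le_union hη.le hDD'.1 hC (hy1' _ Finset.subset_union_right
      (hqC.trans Finset.subset_union_left))
  · intro C hC hqC
    exact hD.le_of_smul_subset hη.le hDD'.2 hy1' hC hqC
  · intro C hC hqC hgqC
    rw [Finset.smul_finset_singleton] at hgqC
    have h2 : (1 : ℝ) * (η - c) ≤ k * (η - c) := by
      have : (1 : ℝ) ≤ k := by exact_mod_cast hk
      have : 0 ≤ η - c := by linarith
      gcongr
    have h3 : H.predim η D + (2 * η - c') ≤ H.predim η D + (1 - 0 + k * (η - c)) := by linarith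
    refine h3.trans ?_
    refine hD.le_of_le_union hη.le hDD'.1 hC ?_
    rw [← add_assoc]
    exact hy2 (C ∪ D') Finset.subset_union_right
      (Finset.mem_union_left _ (by simpa using hqC))
      (Finset.mem_union_left _ (by simpa using hgqC))

lemma IsHrushovskiGeneric.hasIndependentBlocks_zero (hs : 2 ≤ s) (hη₀ : 0 < η) (hη₁ : η ≤ 1)
    (hdeg : ¬ (s = 2 ∧ η = 1)) (hH : H.IsHrushovskiGeneric η) {g : H.Aut} (hg : g ≠ 1) :
    HasIndependentBlocks η H g 0 := by
  rcases hs.eq_or_lt with h | h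
  · have hs2 : s = 2 := h.symm
    have hη : 0 < 1 - η := by
      have : η < 1 := lt_of_le_of_ne hη₁ fun h' => hdeg ⟨hs2, h'⟩
      linarith
    -- Free vertices give defect `2 * η - 1 ≤ η` to start with. Since `η < 1`, finitely many
    -- improvements reach `0`.
    have key : ∀ n : ℕ, HasIndependentBlocks η H g (max 0 (η - n * (1 - η))) := by
      intro n
      induction n with
      | zero =>
        refine hH.hasIndependentBlocks_of_free hs hη₀.le hη₁ hdeg hg ?_
        refine le_trans ?_ (le_max_right _ _)
        rw [hs2]
        push_cast
        linarith
      | succ n ih =>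
        have hn : 0 ≤ (n : ℝ) * (1 - η) := by positivity
        refine hH.hasIndependentBlocks_improve hs2 hη₀ hη₁ (le_max_left _ _)
          (max_le hη₀.le (by linarith)) ?_ ih
        push_cast
        rcases le_total 0 (η - n * (1 - η)) with h | h
        · rw [max_eq_right h]
          exact le_trans (by linarith) (le_max_right _ _)
        · rw [max_eq_left h]
          exact le_trans (by linarith) (le_max_left _ _)
    obtain ⟨n, hn⟩ := exists_nat_ge (η / (1 - η))
    have h1 := key n
    rwa [max_eq_left] at h1
    rw [div_le_iff₀ hη] at hn
    linarith
  · refine hH.hasIndependentBlocks_of_free hs hη₀.le hη₁ hdeg hg ?_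
    have : (3 : ℝ) ≤ s := by exact_mod_cast h
    linarith

/-- The vertex `u` has relative dimension at least `η` over `A`. -/
def IndependentOver (η : ℝ) (H : UniformHypergraph s V) (A : Finset V) (u : V) : Prop :=
  ∀ X, A ⊆ X → u ∈ X → H.predim η A + η ≤ H.predim η X

lemma IndependentOver.notMem (hη : 0 < η) {A : Finset V} {u : V}
    (h : IndependentOver η H A u) : u ∉ A := fun hu => by
  have := h A subset_rfl hu
  linarith

lemma IndependentOver.mono (hη : 0 ≤ η) {A D : Finset V} {u : V}
    (h : IndependentOver η H D u) (hA : H.Strong η A) (hAD : A ⊆ D) :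
    IndependentOver η H A u := fun _ hX hu =>
  hA.le_of_le_union hη hAD hX (h _ Finset.subset_union_right (Finset.mem_union_left _ hu))

lemma IndependentOver.smul {A : Finset V} {u : V} (h : IndependentOver η H A u) (x : H.Aut) :
    IndependentOver η H (x • A) (x • u) := by
  intro X hX hu
  rw [predim_smul, ← predim_smul x⁻¹ X]
  exact h _ (by rwa [← Finset.smul_finset_subset_iff]) (by rwa [Finset.mem_inv_smul_finset_iff])

/-- If `u` is independent over `A`, then `x` can be changed outside `A` so that `g • x • u` becomes
independent over large sets. -/
lemma IsHrushovskiGeneric.exists_independent_image (hs : 2 ≤ s) (hη₀ : 0 < η) (hη₁ : η ≤ 1)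
    (hdeg : ¬ (s = 2 ∧ η = 1)) (hH : H.IsHrushovskiGeneric η) (x : H.Aut) {A : Finset V}
    (hA : H.Strong η A) {u : V} (hu : IndependentOver η H A u) (g : H.Aut) (D : Finset V) :
    ∃ x' : H.Aut, (∀ a ∈ A, x' • a = x • a) ∧ ∃ A' Q : Finset V, H.Strong η A' ∧
      H.Strong η Q ∧ A ⊆ A' ∧ u ∈ A' ∧ D ⊆ Q ∧ A' ⊆ Q ∧ (g ≠ 1 → x' • A' ⊆ Q) ∧
      IndependentOver η H Q (g • x' • u) := by
  obtain ⟨B, hAB, hB, hmin⟩ := hH.exists_closure hη₀.le (insert u A)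
  rw [Finset.insert_subset_iff] at hAB
  obtain ⟨huB, hAB⟩ := hAB
  have hgen : ∀ X, A ⊆ X → u ∈ X → H.predim η B ≤ H.predim η X :=
    fun X hX huX => hmin X (Finset.insert_subset huX hX)
  have hdim := hu B hAB huB
  obtain ⟨D₀, hD₀, hD₀s⟩ := hH.exists_strong (B ∪ x⁻¹ • (D ∪ B))
  rw [Finset.union_subset_iff, Finset.smul_finset_subset_iff, inv_inv,
    Finset.union_subset_iff] at hD₀
  obtain ⟨hBD₀, hDD₀, hBD₀'⟩ := hD₀
  by_cases hg : g = 1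
  · obtain ⟨y, hyA, -, hy⟩ := hH.exists_free_copy (by omega) hη₀ hAB hA hB hD₀s
      (hAB.trans hBD₀) huB (hu.notMem hη₀) hgen
    refine ⟨x * y, fun a ha => by rw [mul_smul, hyA a ha], B, x • D₀, hB, hD₀s.smul x, hAB, huB,
      hDD₀, hBD₀', fun h => absurd hg h, ?_⟩
    rw [hg, one_smul, mul_smul]
    refine IndependentOver.smul (fun C hC hC' => ?_) x
    have := hy C hC hC'
    linarith
  · have hg' : x⁻¹ * g * x ≠ 1 := by
      intro h
      refine hg ?_
      rw [mul_assoc, inv_mul_eq_one] at h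
      exact mul_eq_right.1 h.symm
    -- Enlarging `A` to a maximal `A₁` over which `B` still has relative dimension at least `η`
    -- makes every proper intermediate set satisfy the primitivity condition.
    obtain ⟨A₁, hA₁, hmax⟩ := Finset.exists_max_image
      (B.powerset.filter fun X => A ⊆ X ∧ H.predim η X + η ≤ H.predim η B) Finset.card
      ⟨A, by simp [hAB, hdim]⟩
    simp only [Finset.mem_filter, Finset.mem_powerset] at hA₁ hmax
    obtain ⟨hA₁B, hAA₁, hA₁δ⟩ := hA₁
    have hprim : ∀ X, A₁ ⊂ X → X ⊆ B → H.predim η B - η < H.predim η X := by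
      intro X hX hXB
      by_contra! h
      have := hmax X ⟨hXB, hAA₁.trans hX.1, by linarith⟩
      exact absurd (Finset.card_lt_card hX) (by omega)
    have hA₁s : H.Strong η A₁ := by
      rw [strong_iff]
      intro X hX
      refine le_trans ?_ (hB.predim_inter_le hη₀.le X)
      rcases (Finset.subset_inter hX hA₁B).eq_or_ssubset with h | h
      · rw [← h]
      · have := hprim _ h Finset.inter_subset_right
        linarith
    have huA₁ : u ∉ A₁ := by
      intro h
      have := hgen A₁ hAA₁ h
      linarith
    obtain ⟨y, hyA, -, hy1, k, hk, hy2⟩ := hH.exists_generic_copy (by omega) hη₀ le_rfl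
      (hH.hasIndependentBlocks_zero hs hη₀ hη₁ hdeg hg') hA₁B hA₁s hB hD₀s (hA₁B.trans hBD₀) huB
      huA₁ (fun X hX => hgen X (hAA₁.trans hX)) hprim hA₁δ
    have hyA' : A₁ ⊆ y • B := fun a ha => by
      rw [← hyA a ha]
      exact Finset.smul_mem_smul_finset (hA₁B ha)
    have hyu : y • u ∈ D₀ ∪ y • B :=
      Finset.mem_union_right _ (Finset.smul_mem_smul_finset huB)
    have hQ : H.predim η (D₀ ∪ y • B) ≤ H.predim η D₀ + (H.predim η B - H.predim η A₁) := by
      have h1 := predim_submodular hη₀.le H D₀ (y • B)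
      have h2 := strong_iff.1 hA₁s (D₀ ∩ y • B) (Finset.subset_inter (hA₁B.trans hBD₀) hyA')
      rw [predim_smul] at h1
      linarith
    -- Its predimension attains the lower bound valid for all sets containing `D₀` and `y • u`.
    have hQs : H.Strong η (D₀ ∪ y • B) := strong_iff.2 fun X hX =>
      hQ.trans (hy1 X (Finset.subset_union_left.trans hX) (hX hyu))
    refine ⟨x * y, fun a ha => by rw [mul_smul, hyA a (hAA₁ ha)], B, x • (D₀ ∪ y • B), hB,
      hQs.smul x, hAB, huB, hDD₀.trans ?_, hBD₀'.trans ?_, fun _ => ?_, ?_⟩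
    · exact Finset.smul_finset_subset_smul_finset Finset.subset_union_left
    · exact Finset.smul_finset_subset_smul_finset Finset.subset_union_left
    · rw [mul_smul]
      exact Finset.smul_finset_subset_smul_finset Finset.subset_union_right
    -- The copy was made generic for the conjugate of `g` by `x`, since `y` is applied before `x`.
    · have h1 : g • (x * y) • u = x • (x⁻¹ * g * x) • y • u := by
        simp [smul_smul, mul_assoc]
      rw [h1]
      refine IndependentOver.smul (fun C hC hC' => ?_) x
      have h2 := hy2 C (Finset.subset_union_left.trans hC) (hC hyu) hC'
      have h3 : (1 : ℝ) * η ≤ k * η := by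
        have : (1 : ℝ) ≤ k := by exact_mod_cast hk
        gcongr
      linarith

end Step

end UniformHypergraph

/-! ### Reduction of words. -/

section Words

variable {G : Type*} [Group G]

/-- The value at `x` of the word `x ^ ε₁ * g₁ * ⋯ * x ^ εₙ * gₙ`. -/
def evalWord (w : List (ℤˣ × G)) (x : G) : G :=
  (w.map fun p => x ^ (p.1 : ℤ) * p.2).prod

/-- A word without cancelling neighbours. -/
def IsReducedWord (w : List (ℤˣ × G)) : Prop :=
  w.IsChain fun p q => q.1 = -p.1 → p.2 ≠ 1

lemma evalWord_nil (x : G) : evalWord [] x = 1 := rfl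

lemma evalWord_cons (p : ℤˣ × G) (w : List (ℤˣ × G)) (x : G) :
    evalWord (p :: w) x = x ^ (p.1 : ℤ) * p.2 * evalWord w x := by
  simp [evalWord]

/-- A word starts with a power of `x`, so cancelling its first letters can leave a constant in
front. This is why the factor `c` appears. -/
lemma exists_isReducedWord (w : List (ℤˣ × G)) :
    ∃ (c : G) (w' : List (ℤˣ × G)), IsReducedWord w' ∧ ∀ x, evalWord w x = c * evalWord w' x := by
  induction w with
  | nil => exact ⟨1, [], List.isChain_nil, fun x => by rw [one_mul]⟩
  | cons p w ih =>
    obtain ⟨c, w', hw', h⟩ := ih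
    rcases w' with _ | ⟨q, w'⟩
    · exact ⟨1, [(p.1, p.2 * c)], List.isChain_singleton _, fun x => by
        simp [evalWord_cons, evalWord_nil, h, mul_assoc]⟩
    · by_cases hq : q.1 = -p.1 ∧ p.2 * c = 1
      · refine ⟨q.2, w', hw'.tail, fun x => ?_⟩
        have h1 : x ^ (p.1 : ℤ) * p.2 * (c * (x ^ (q.1 : ℤ) * q.2 * evalWord w' x)) =
            x ^ (p.1 : ℤ) * (p.2 * c) * x ^ (q.1 : ℤ) * (q.2 * evalWord w' x) := by group
        rw [evalWord_cons, h, evalWord_cons, h1, hq.2, hq.1]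
        simp
      · refine ⟨1, (p.1, p.2 * c) :: q :: w', List.isChain_cons_cons.2 ⟨?_, hw'⟩, fun x => ?_⟩
        · exact fun h1 h2 => hq ⟨h1, h2⟩
        · rw [evalWord_cons, h, evalWord_cons (p.1, p.2 * c)]
          simp [mul_assoc]

end Words

namespace UniformHypergraph

/-! ### Following a vertex along a word. -/

section WordMaps

open Classical
open scoped Pointwise

variable {s : ℕ} {V : Type*} {η : ℝ} {H : UniformHypergraph s V}

/-- The domain `A` or the image `x • A`, according to the sign `ε`. -/
noncomputable def signedSide (ε : ℤˣ) (x : H.Aut) (A : Finset V) : Finset V :=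
  if ε = 1 then A else x • A

lemma signedSide_one (x : H.Aut) (A : Finset V) : signedSide 1 x A = A := if_pos rfl

lemma signedSide_neg_one (x : H.Aut) (A : Finset V) : signedSide (-1) x A = x • A :=
  if_neg (by decide)

lemma Strong.signedSide {A : Finset V} (hA : H.Strong η A) (ε : ℤˣ) (x : H.Aut) :
    H.Strong η (signedSide ε x A) := by
  rcases Int.units_eq_one_or ε with rfl | rfl
  · rwa [signedSide_one]
  · rw [signedSide_neg_one]
    exact hA.smul x

lemma IsHrushovskiGeneric.exists_signed_step (hs : 2 ≤ s) (hη₀ : 0 < η) (hη₁ : η ≤ 1)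
    (hdeg : ¬ (s = 2 ∧ η = 1)) (hH : H.IsHrushovskiGeneric η) (ε : ℤˣ) (x : H.Aut) {A : Finset V}
    (hA : H.Strong η A) {u : V} (hu : IndependentOver η H (signedSide ε x A) u) (g : H.Aut)
    (D : Finset V) :
    ∃ x' : H.Aut, (∀ a ∈ A, x' • a = x • a) ∧ ∃ (A' Q : Finset V) (v : V), H.Strong η A' ∧
      H.Strong η Q ∧ A ⊆ A' ∧ D ⊆ Q ∧
      (∀ x'' : H.Aut, (∀ a ∈ A', x'' • a = x' • a) → x'' ^ (ε : ℤ) • u = v) ∧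
      IndependentOver η H Q (g • v) ∧ signedSide ε x' A' ⊆ Q ∧
      (g ≠ 1 → signedSide (-ε) x' A' ⊆ Q) := by
  rcases Int.units_eq_one_or ε with rfl | rfl
  · rw [signedSide_one] at hu
    obtain ⟨x', h1, A', Q, h2, h3, h4, h5, h6, h7, h8, h9⟩ :=
      hH.exists_independent_image hs hη₀ hη₁ hdeg x hA hu g D
    refine ⟨x', h1, A', Q, x' • u, h2, h3, h4, h6, fun x'' hx => ?_, h9, ?_, ?_⟩
    · simpa using hx u h5
    · rwa [signedSide_one]
    · rwa [signedSide_neg_one]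
  -- The inverse letter is the positive case for `x⁻¹`, with the range `x • A` as its domain.
  · rw [signedSide_neg_one] at hu
    obtain ⟨x', h1, A', Q, h2, h3, h4, h5, h6, h7, h8, h9⟩ :=
      hH.exists_independent_image hs hη₀ hη₁ hdeg x⁻¹ (hA.smul x) hu g D
    have h1' : ∀ a ∈ A, x' • x • a = a := fun a ha => by
      rw [h1 _ (Finset.smul_mem_smul_finset ha), inv_smul_smul]
    refine ⟨x'⁻¹, fun a ha => ?_, x' • A', Q, x' • u, h2.smul x', h3, fun a ha => ?_, h6,
      fun x'' hx => ?_, h9, ?_, ?_⟩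
    · rw [inv_smul_eq_iff, h1' a ha]
    · rw [← h1' a ha]
      exact Finset.smul_mem_smul_finset (h4 (Finset.smul_mem_smul_finset ha))
    · have := hx _ (Finset.smul_mem_smul_finset h5)
      rw [inv_smul_smul] at this
      simp only [Units.val_neg, Units.val_one, zpow_neg, zpow_one]
      rw [inv_smul_eq_iff, this]
    · rw [signedSide_neg_one, inv_smul_smul]
      exact h7
    · rw [neg_neg, signedSide_one]
      exact h8

lemma IsHrushovskiGeneric.exists_independentOver (hs : 2 ≤ s) (hη₀ : 0 < η) (hη₁ : η ≤ 1)
    (hH : H.IsHrushovskiGeneric η) {D : Finset V} (hD : H.Strong η D) :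
    ∃ v, IndependentOver η H D v := by
  obtain ⟨q, hq⟩ := hH.exists_free_vertex hs hη₀.le
  have hq1 : H.predim η {q} = 1 := predim_singleton hs q
  obtain ⟨y, -, -, hy⟩ := hH.exists_free_copy (by omega) hη₀ (Finset.empty_subset {q})
    (hH.strong_empty (by omega))
    (strong_iff.2 fun X hX => by rw [hq1]; exact hq X (by simpa using hX)) hD
    (Finset.empty_subset _) (Finset.mem_singleton_self q) (Finset.notMem_empty q)
    (fun X _ hX => by rw [hq1]; exact hq X hX)
  refine ⟨y • q, fun C hC hqC => ?_⟩
  have := hy C hC hqC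
  rw [hq1, predim_empty (by omega)] at this
  linarith

/-- Letters act from the right, so `p` is the letter applied next. Carrying it along lets the
invariant name the constant `p.2` and the side on which its power of `y` will act. -/
lemma IsHrushovskiGeneric.exists_path (hs : 2 ≤ s) (hη₀ : 0 < η) (hη₁ : η ≤ 1)
    (hdeg : ¬ (s = 2 ∧ η = 1)) (hH : H.IsHrushovskiGeneric η) (w : List (ℤˣ × H.Aut)) :
    ∀ (p : ℤˣ × H.Aut), IsReducedWord (p :: w) → ∀ (x : H.Aut) (A : Finset V),
      ∃ y : H.Aut, (∀ a ∈ A, y • a = x • a) ∧ ∃ (A' : Finset V) (v u : V), H.Strong η A' ∧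
        A ⊆ A' ∧ (∀ y' : H.Aut, (∀ a ∈ A', y' • a = y • a) → evalWord w y' • v = u) ∧
        IndependentOver η H (signedSide p.1 y A') (p.2 • u) := by
  induction w with
  | nil =>
    intro p _ x A
    obtain ⟨A', hAA', hA'⟩ := hH.exists_strong A
    obtain ⟨v, hv⟩ := hH.exists_independentOver hs hη₀ hη₁ (hA'.signedSide p.1 x)
    refine ⟨x, fun _ _ => rfl, A', p.2⁻¹ • v, p.2⁻¹ • v, hA', hAA', fun y' _ => ?_, ?_⟩
    · rw [evalWord_nil, one_smul]
    · rwa [smul_inv_smul]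
  | cons q w ih =>
    intro p hp x A
    obtain ⟨hpq, hq⟩ := List.isChain_cons_cons.1 hp
    obtain ⟨y, hy, A', v, u, hA', hAA', hvu, hu⟩ := ih q hq x A
    obtain ⟨x', hx', A'', Q, v', hA'', hQ, hA'A'', -, hv', hind, hQ1, hQ2⟩ :=
      hH.exists_signed_step hs hη₀ hη₁ hdeg q.1 y hA' hu p.2 ∅
    refine ⟨x', fun a ha => (hx' a (hAA' ha)).trans (hy a ha), A'', v, v', hA'',
      hAA'.trans hA'A'', fun y' hy' => ?_, hind.mono hη₀.le (hA''.signedSide _ _) ?_⟩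
    · rw [evalWord_cons, mul_smul, mul_smul,
        hvu y' fun a ha => (hy' a (hA'A'' ha)).trans (hx' a ha), hv' y' hy']
    -- With equal signs the next letter acts on the side where the last one started. With opposite
    -- signs it acts on the side where the vertex has just arrived, and reducedness supplies `p.2 ≠
    -- 1`.
    · by_cases h : q.1 = -p.1
      · have := hQ2 (hpq h)
        rwa [h, neg_neg] at this
      · have h' : p.1 = q.1 := by
          rcases Int.units_eq_one_or p.1 with h1 | h1 <;>
            rcases Int.units_eq_one_or q.1 with h2 | h2 <;> simp [h1, h2] at h ⊢
        rwa [h']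

/-- Nonempty reduced words avoid a given value on a dense open set of automorphisms. -/
lemma IsHrushovskiGeneric.exists_evalWord_ne (hs : 2 ≤ s) (hη₀ : 0 < η) (hη₁ : η ≤ 1)
    (hdeg : ¬ (s = 2 ∧ η = 1)) (hH : H.IsHrushovskiGeneric η) {w : List (ℤˣ × H.Aut)}
    (hw : IsReducedWord w) (hne : w ≠ []) (c x : H.Aut) (A : Finset V) :
    ∃ (y : H.Aut) (A' : Finset V), A ⊆ A' ∧ (∀ a ∈ A, y • a = x • a) ∧
      ∀ y' : H.Aut, (∀ a ∈ A', y' • a = y • a) → evalWord w y' ≠ c := by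
  rcases w with _ | ⟨p, w⟩
  · exact absurd rfl hne
  obtain ⟨y, hy, A', v, u, hA', hAA', hvu, hu⟩ := hH.exists_path hs hη₀ hη₁ hdeg w p hw x A
  -- In the last step no constant follows, whence `g = 1`; the vertex is only required to avoid the
  -- forbidden value `c • v`.
  obtain ⟨x', hx', A'', Q, v', hA'', hQ, hA'A'', hDQ, hv', hind, -, -⟩ :=
    hH.exists_signed_step hs hη₀ hη₁ hdeg p.1 y hA' hu 1 {c • v}
  refine ⟨x', A'', hAA'.trans hA'A'', fun a ha => (hx' a (hAA' ha)).trans (hy a ha),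
    fun y' hy' hc => ?_⟩
  have h1 : evalWord (p :: w) y' • v = v' := by
    rw [evalWord_cons, mul_smul, mul_smul,
      hvu y' fun a ha => (hy' a (hA'A'' ha)).trans (hx' a ha), hv' y' hy']
  refine hind.notMem hη₀ ?_
  rw [one_smul, ← h1, hc]
  exact hDQ (Finset.mem_singleton_self _)

/-- Finitely many nonempty basic Zariski open sets have a common point. -/
lemma IsHrushovskiGeneric.exists_mem_sInter (hs : 2 ≤ s) (hη₀ : 0 < η) (hη₁ : η ≤ 1)
    (hdeg : ¬ (s = 2 ∧ η = 1)) (hH : H.IsHrushovskiGeneric η) {F : Set (Set H.Aut)}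
    (hF : F.Finite) (hFw : ∀ U ∈ F, ∃ w : List (ℤˣ × H.Aut), U = {x | evalWord w x ≠ 1})
    (hne : ∀ U ∈ F, U.Nonempty) (x : H.Aut) (A : Finset V) :
    ∃ (y : H.Aut) (A' : Finset V), A ⊆ A' ∧ (∀ a ∈ A, y • a = x • a) ∧
      ∀ y' : H.Aut, (∀ a ∈ A', y' • a = y • a) → y' ∈ ⋂₀ F := by
  induction F, hF using Set.Finite.induction_on with
  | empty => exact ⟨x, A, subset_rfl, fun _ _ => rfl, fun _ _ => by simp⟩
  | @insert U F _ _ ih =>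
    obtain ⟨y, A', hAA', hy, hyF⟩ := ih (fun U hU => hFw U (Set.mem_insert_of_mem _ hU))
      (fun U hU => hne U (Set.mem_insert_of_mem _ hU))
    obtain ⟨w, rfl⟩ := hFw _ (Set.mem_insert _ _)
    obtain ⟨x₀, hx₀⟩ := hne _ (Set.mem_insert _ _)
    obtain ⟨c, w', hw', hww'⟩ := exists_isReducedWord w
    have key : ∃ (z : H.Aut) (A'' : Finset V), A' ⊆ A'' ∧ (∀ a ∈ A', z • a = y • a) ∧
        ∀ y' : H.Aut, (∀ a ∈ A'', y' • a = z • a) → evalWord w y' ≠ 1 := by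
      by_cases hnil : w' = []
      -- Here the word is constant, and one point where it differs from `1` settles all others.
      · refine ⟨y, A', subset_rfl, fun _ _ => rfl, fun y' _ => ?_⟩
        have h1 := hww' x₀
        have h2 := hww' y'
        rw [hnil, evalWord_nil] at h1 h2
        rw [h2, ← h1]
        exact hx₀
      · obtain ⟨z, A'', h1, h2, h3⟩ := hH.exists_evalWord_ne hs hη₀ hη₁ hdeg hw' hnil c⁻¹ y A'
        refine ⟨z, A'', h1, h2, fun y' hy' h => h3 y' hy' ?_⟩
        rw [hww'] at h
        exact eq_inv_of_mul_eq_one_right h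
    obtain ⟨z, A'', h1, h2, h3⟩ := key
    refine ⟨z, A'', hAA'.trans h1, fun a ha => (h2 a (hAA' ha)).trans (hy a ha), fun y' hy' => ?_⟩
    rw [Set.sInter_insert]
    exact ⟨h3 y' hy', hyF y' fun a ha => (hy' a (h1 ha)).trans (h2 a ha)⟩

lemma IsHrushovskiGeneric.exists_aut_ne_one (hs : 2 ≤ s) (hη₀ : 0 < η)
    (hH : H.IsHrushovskiGeneric η) : ∃ h : H.Aut, h ≠ 1 := by
  obtain ⟨q, hq⟩ := hH.exists_free_vertex hs hη₀.le
  have hq1 : H.predim η {q} = 1 := predim_singleton hs q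
  obtain ⟨D, hqD, hD⟩ := hH.exists_strong {q}
  obtain ⟨y, -, hy, -⟩ := hH.exists_free_copy (by omega) hη₀ (Finset.empty_subset {q})
    (hH.strong_empty (by omega))
    (strong_iff.2 fun X hX => by rw [hq1]; exact hq X (by simpa using hX)) hD
    (Finset.empty_subset _) (Finset.mem_singleton_self q) (Finset.notMem_empty q)
    (fun X _ hX => by rw [hq1]; exact hq X hX)
  refine ⟨y, fun h => hy ?_⟩
  rw [h, one_smul]
  exact Finset.singleton_subset_iff.1 hqD

end WordMaps

end UniformHypergraph

theorem theoremF {s : ℕ} (hs : 2 ≤ s) {η : ℝ} (hη₀ : 0 < η) (hη₁ : η ≤ 1)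
    (hdeg : ¬ (s = 2 ∧ η = 1)) {M : Type*} (H : UniformHypergraph s M)
    (hH : H.IsHrushovskiGeneric η) :
    ¬ @IsTopologicalGroup H.Aut (groupZariskiTopology H.Aut) _ := by
  intro htop
  let _ : TopologicalSpace H.Aut := groupZariskiTopology H.Aut
  have : IsTopologicalGroup H.Aut := htop
  -- Complements of points are basic open, via the word `x * h⁻¹`. In a topological group this
  -- already implies the Hausdorff property used below.
  have : T1Space H.Aut := by
    refine ⟨fun h => ⟨TopologicalSpace.isOpen_generateFrom_of_mem ⟨[(1, h⁻¹)], ?_⟩⟩⟩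
    ext x
    simp [mul_inv_eq_one]
  obtain ⟨h, hh⟩ := hH.exists_aut_ne_one hs hη₀
  obtain ⟨U, U', hU, hU', h1, h2, hdisj⟩ := t2_separation hh.symm
  have hbasis := TopologicalSpace.isTopologicalBasis_of_subbasis
    (rfl : (inferInstance : TopologicalSpace H.Aut) = groupZariskiTopology H.Aut)
  obtain ⟨_, ⟨F, ⟨hF, hFs⟩, rfl⟩, h1F, hFU⟩ := hbasis.exists_subset_of_mem_open h1 hU
  obtain ⟨_, ⟨F', ⟨hF', hFs'⟩, rfl⟩, h2F, hFU'⟩ := hbasis.exists_subset_of_mem_open h2 hU'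
  -- The two basic neighbourhoods are finite intersections of sets that contain `1` or `h`, so all
  -- these sets together have a common point.
  obtain ⟨y, A, -, -, hy⟩ := hH.exists_mem_sInter hs hη₀ hη₁ hdeg (hF.union hF')
    (by
      rintro W (hW | hW)
      · exact hFs hW
      · exact hFs' hW)
    (by
      rintro W (hW | hW)
      · exact ⟨1, h1F W hW⟩
      · exact ⟨h, h2F W hW⟩) 1 ∅
  have hyF := hy y fun _ _ => rfl
  rw [Set.sInter_union] at hyF
  exact Set.disjoint_left.1 hdisj (hFU hyF.1) (hFU' hyF.2)
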